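/- Let $F$ be a nonarchimedean local field (of characteristic $0$ or $2$) whose residue field $\mathfrak f$ has characteristic $2$, let $q=|\mathfrak f|$, and let $\mathcal R$ be the ring of integers of $F$, $\mathcal P$ its maximal ideal and $\varpi$ a uniformizer. Let $e\in\mathbb N\cup\{\infty\}$ be the valuation of $2$, so that $2\in\varpi^e\mathcal R^\times$ if $\operatorname{char}F=0$, and $e=\infty$ if $\operatorname{char}F=2$. Put $\mathcal K'=\mathrm{SL}(2,\mathcal R)$ and $g_\ell=\operatorname{diag}(\varpi^\ell,1)$, and for $\ell\ge 1$ let $B'_\ell\subset\mathcal K'$ be the subgroup of matrices that are lower triangular modulo $\mathcal P^\ell$. Let $\sigma$ be a cuspidal complex representation of $\mathrm{SL}(2,\mathfrak f)$ (irreducible, with no nonzero vector fixed by the group of upper unipotent matrices), and write $\sigma$ also for its inflation to $\mathcal K'$. For $\ell\geq 1$ let ${}^{g_\ell}\sigma$ be the representation $b\mapsto\sigma(g_\ell^{-1}bg_\ell)$ of $B'_\ell$, and put $\sigma(\ell)=\mathrm{Ind}_{B'_\ell}^{\mathcal K'}\,{}^{g_\ell}\sigma$ (smooth induction). For $k\ge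 1$ let $\mathcal S_k$ be a set of representatives of the square classes of units modulo $\mathcal P^k$, that is, of $\mathcal R^\times/(\mathcal R^\times)^2(1+\mathcal P^k)$. Then for every integer $\ell\ge 1$, $$\dim\operatorname{End}_{\mathcal K'}(\sigma(\ell))=|\mathcal S_{\lceil \ell/2\rceil}|=\begin{cases} q^{\lfloor(\ell+1)/4\rfloor} & \text{if } \ell\le 4e,\\ 2q^e & \text{if } \ell\ge 4e+1,\end{cases}$$ where for $e=\infty$ the first case always applies. -/

import Mathlib

open ValuativeRel
open scoped MatrixGroups

namespace BranchingSL2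

/-! ### Smooth induction and cuspidal representations -/

section Induction

variable {G W : Type*} [Group G] [TopologicalSpace G] [IsTopologicalGroup G]
  [AddCommGroup W] [Module ℂ W]

/-- The space of locally constant functions `f : G → W` with `f (h g) = ρ(h) f(g)` for all
`h ∈ H`, `g ∈ G`.  (For compact `G`, the only case used, the requirement of compact support modulo
`H` is vacuous.) -/
def smoothIndV (H : Subgroup G) (ρ : Representation ℂ H W) : Submodule ℂ (G → W) where
  carrier := {f | (∀ (h : H) (g : G), f (h * g) = ρ h (f g)) ∧ IsLocallyConstant f}
  add_mem' := fun ha hb => ⟨fun h g => by simp [ha.1 h g, hb.1 h g], ha.2.add hb.2⟩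
  zero_mem' := ⟨fun h g => by simp, IsLocallyConstant.const 0⟩
  smul_mem' := fun c f hf => ⟨fun h g => by simp [hf.1 h g], hf.2.comp (fun w => c • w)⟩

/-- The induced representation of `ρ` from `H` to `G`: right translation on `smoothIndV H ρ`. -/
def smoothInd (H : Subgroup G) (ρ : Representation ℂ H W) :
    Representation ℂ G (smoothIndV H ρ) where
  toFun g := (LinearMap.funLeft ℂ W (fun x : G => x * g)).restrict fun f hf =>
    ⟨fun h x => by simpa [LinearMap.funLeft_apply, mul_assoc] using hf.1 h (x * g),
      hf.2.comp_continuous (continuous_mul_const g)⟩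
  map_one' := LinearMap.ext fun f => Subtype.ext (funext fun x => congrArg f.1 (mul_one x))
  map_mul' a b := LinearMap.ext fun f =>
    Subtype.ext (funext fun x => congrArg f.1 (mul_assoc x a b).symm)

end Induction

/-- The upper unipotent matrix `[1 x; 0 1]`. -/
def upperUnipotent {k : Type*} [CommRing k] (x : k) : SL(2, k) :=
  ⟨!![1, x; 0, 1], by simp [Matrix.det_fin_two]⟩

/-- A complex representation of `SL(2, k)` is cuspidal if it is irreducible and has no nonzero
vector fixed by the unipotent radical of a proper parabolic subgroup.  All of these radicals are
conjugate to the group of upper unipotent matrices. -/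
structure IsCuspidal {k W : Type*} [Field k] [AddCommGroup W] [Module ℂ W]
    (σ : Representation ℂ SL(2, k) W) : Prop where
  irreducible : σ.IsIrreducible
  no_fixed_vector : ∀ v : W, (∀ x : k, σ (upperUnipotent x) v = v) → v = 0

/-! ### The Mackey components -/

section LocalField

variable (F : Type*) [Field F] [ValuativeRel F] [TopologicalSpace F] [IsNonarchimedeanLocalField F]

set_option linter.unusedSectionVars false

/-- The subgroup of `SL(2, 𝒪)` of matrices that are lower triangular modulo the `ℓ`-th power of the
maximal ideal. -/
def lowerMod (ℓ : ℕ) : Subgroup SL(2, 𝒪[F]) where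
  carrier := {g | g 0 1 ∈ 𝓂[F] ^ ℓ}
  one_mem' := by simp
  mul_mem' := by
    intro a b ha hb
    simp only [Set.mem_ofPred_eq, Matrix.SpecialLinearGroup.coe_mul, Matrix.mul_apply,
      Fin.sum_univ_two] at *
    exact Ideal.add_mem _ (Ideal.mul_mem_left _ _ hb) (Ideal.mul_mem_right _ _ ha)
  inv_mem' := by
    intro a ha
    simpa [Matrix.SpecialLinearGroup.coe_inv, Matrix.adjugate_fin_two] using ha

/-- The inclusion of `SL(2, 𝒪)` into `GL(2, F)`. -/
noncomputable def inclGL : SL(2, 𝒪[F]) →* GL (Fin 2) F :=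
  Matrix.SpecialLinearGroup.toGL.comp (Matrix.SpecialLinearGroup.map (algebraMap 𝒪[F] F))

lemma inclGL_apply (g : SL(2, 𝒪[F])) (i j : Fin 2) :
    (inclGL F g : Matrix (Fin 2) (Fin 2) F) i j = (g i j : F) := rfl

lemma inclGL_injective : Function.Injective (inclGL F) := by
  intro a b h
  ext i j
  rw [← inclGL_apply, ← inclGL_apply, h]

variable {F}

lemma coe_ne_zero {ϖ : 𝒪[F]} (hϖ : Irreducible ϖ) : (ϖ : F) ≠ 0 := by
  simpa using hϖ.ne_zero

/-- The element `g_ℓ = diag(ϖ ^ ℓ, 1)` of `GL(2, F)`. -/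
noncomputable def diagG {ϖ : 𝒪[F]} (hϖ : Irreducible ϖ) (ℓ : ℕ) : GL (Fin 2) F :=
  Matrix.GeneralLinearGroup.mkOfDetNeZero !![(ϖ : F) ^ ℓ, 0; 0, 1]
    (by simp [Matrix.det_fin_two, coe_ne_zero hϖ])

lemma exists_conj {ϖ : 𝒪[F]} (hϖ : Irreducible ϖ) (ℓ : ℕ) (b : lowerMod F ℓ) :
    ∃ k : SL(2, 𝒪[F]), inclGL F k = (diagG hϖ ℓ)⁻¹ * inclGL F b * diagG hϖ ℓ := by
  obtain ⟨b, hb⟩ := b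
  have hb' : b 0 1 ∈ 𝓂[F] ^ ℓ := hb
  rw [hϖ.maximalIdeal_eq, Ideal.span_singleton_pow, Ideal.mem_span_singleton] at hb'
  obtain ⟨c, hc⟩ := hb'
  have hdet := b.det_coe
  rw [Matrix.det_fin_two] at hdet
  have hk : (!![b 0 0, c; b 1 0 * ϖ ^ ℓ, b 1 1] : Matrix (Fin 2) (Fin 2) 𝒪[F]).det = 1 := by
    rw [Matrix.det_fin_two_of]
    linear_combination hdet + b 1 0 * hc
  have hcF : ((b 0 1 : 𝒪[F]) : F) = (ϖ : F) ^ ℓ * (c : F) := by rw [hc]; simp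
  obtain ⟨k, h00, h01, h10, h11⟩ : ∃ k : SL(2, 𝒪[F]), k 0 0 = b 0 0 ∧ k 0 1 = c ∧
      k 1 0 = b 1 0 * ϖ ^ ℓ ∧ k 1 1 = b 1 1 := ⟨⟨_, hk⟩, rfl, rfl, rfl, rfl⟩
  have key : diagG hϖ ℓ * inclGL F k = inclGL F b * diagG hϖ ℓ := by
    ext i j
    simp only [Matrix.GeneralLinearGroup.coe_mul, Matrix.mul_apply, Fin.sum_univ_two, inclGL_apply]
    fin_cases i <;> fin_cases j <;>
      simp [diagG, Matrix.GeneralLinearGroup.mkOfDetNeZero, hcF, h00, h01, h10, h11, mul_comm]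
  exact ⟨k, Eq.trans (eq_inv_mul_iff_mul_eq.mpr key) (mul_assoc _ _ _).symm⟩

/-- The homomorphism `b ↦ g_ℓ⁻¹ b g_ℓ` from `lowerMod F ℓ` to `SL(2, 𝒪)`. -/
noncomputable def conjHom {ϖ : 𝒪[F]} (hϖ : Irreducible ϖ) (ℓ : ℕ) :
    lowerMod F ℓ →* SL(2, 𝒪[F]) where
  toFun b := (exists_conj hϖ ℓ b).choose
  map_one' := by
    apply inclGL_injective F
    rw [(exists_conj hϖ ℓ 1).choose_spec]
    simp
  map_mul' a b := by
    apply inclGL_injective F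
    rw [map_mul, (exists_conj hϖ ℓ (a * b)).choose_spec, (exists_conj hϖ ℓ a).choose_spec,
      (exists_conj hϖ ℓ b).choose_spec]
    simp [mul_assoc]

lemma inclGL_conjHom {ϖ : 𝒪[F]} (hϖ : Irreducible ϖ) (ℓ : ℕ) (b : lowerMod F ℓ) :
    inclGL F (conjHom hϖ ℓ b) = (diagG hϖ ℓ)⁻¹ * inclGL F b * diagG hϖ ℓ :=
  (exists_conj hϖ ℓ b).choose_spec

variable {W : Type*} [AddCommGroup W] [Module ℂ W]

/-- The inflation to `SL(2, 𝒪)` of a representation of `SL(2, 𝓀)`. -/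
noncomputable def inflation (σ : Representation ℂ SL(2, 𝓀[F]) W) :
    Representation ℂ SL(2, 𝒪[F]) W :=
  MonoidHom.comp σ (Matrix.SpecialLinearGroup.map (IsLocalRing.residue 𝒪[F]))

/-- The Mackey component `σ(ℓ)`: the representation of `SL(2, 𝒪)` induced from the representation
`b ↦ σ(g_ℓ⁻¹ b g_ℓ)` of the subgroup `lowerMod F ℓ`. -/
noncomputable def mackey {ϖ : 𝒪[F]} (hϖ : Irreducible ϖ)
    (σ : Representation ℂ SL(2, 𝓀[F]) W) (ℓ : ℕ) :
    Representation ℂ SL(2, 𝒪[F])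
      (smoothIndV (lowerMod F ℓ) (MonoidHom.comp (inflation σ) (conjHom hϖ ℓ))) :=
  smoothInd (lowerMod F ℓ) (MonoidHom.comp (inflation σ) (conjHom hϖ ℓ))

/-! ### Square classes of units -/

variable (F)

/-- The subgroup `1 + 𝓂 ^ k` of the units of `𝒪` (all units if `k = 0`). -/
noncomputable def principalUnits (k : ℕ) : Subgroup (𝒪[F])ˣ :=
  (Units.map (Ideal.Quotient.mk (𝓂[F] ^ k)).toMonoidHom).ker

/-- The square classes of units modulo `𝓂 ^ k`, that is, the quotient of `𝒪ˣ` by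
`(𝒪ˣ)² (1 + 𝓂 ^ k)`. -/
abbrev SquareClasses (k : ℕ) : Type _ :=
  (𝒪[F])ˣ ⧸ ((powMonoidHom 2 : (𝒪[F])ˣ →* (𝒪[F])ˣ).range ⊔ principalUnits F k)

lemma mem_principalUnits {k : ℕ} (u : (𝒪[F])ˣ) :
    u ∈ principalUnits F k ↔ (u : 𝒪[F]) - 1 ∈ 𝓂[F] ^ k := by
  rw [← Ideal.Quotient.mk_eq_mk_iff_sub_mem, principalUnits, MonoidHom.mem_ker, Units.ext_iff]
  simp

variable {F}

/-- The exponent `e` with `2 = ι ϖ ^ e`, `ι` a unit; it is `⊤` when `2 = 0` in `F`. -/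
noncomputable def ramIndex (ϖ : 𝒪[F]) : ℕ∞ := emultiplicity ϖ 2

end LocalField

end BranchingSL2

namespace BranchingSL2

/-- If `v₀` is a `χ`-eigenvector of a finite index subgroup `U` and `Λ` a `χ`-equivariant functional
whose translates separate points and which singles out `U` on the orbit of `v₀`, then `T ↦ T v₀`
identifies the endomorphism algebra with the space of `χ`-eigenvectors of `U`. -/
theorem nonempty_end_equiv_eigenvectors {G V : Type*} [Group G] [AddCommGroup V] [Module ℂ V]
    (ρ : Representation ℂ G V) (U : Subgroup G) [U.FiniteIndex] (χ : U → ℂ) (v₀ : V)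
    (Λ : V →ₗ[ℂ] ℂ) (h1 : ∀ u : U, ρ u v₀ = χ u • v₀) (h2 : ∀ (u : U) v, Λ (ρ u v) = χ u * Λ v)
    (h3 : Λ v₀ = 1) (h4 : ∀ g ∉ U, Λ (ρ g v₀) = 0) (h5 : ∀ v, (∀ g, Λ (ρ g v) = 0) → v = 0)
    (X : Submodule ℂ V) (hX : ∀ v, v ∈ X ↔ ∀ u : U, ρ u v = χ u • v) :
    Nonempty (Representation.IntertwiningMap ρ ρ ≃ₗ[ℂ] X) := by
  classical
  have : Fintype (G ⧸ U) := Fintype.ofFinite _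
  have hmul (a b : G) (v : V) : ρ a (ρ b v) = ρ (a * b) v := by simp
  have hχ (u : U) : χ u⁻¹ * χ u = 1 := by
    have h := h2 u⁻¹ (ρ u v₀)
    rw [h2 u, h3, mul_one, hmul, Subgroup.coe_inv, inv_mul_cancel, map_one, Module.End.one_apply, h3] at h
    exact h.symm
  let T (v₁ : V) : V →ₗ[ℂ] V :=
    ∑ x : G ⧸ U, (Λ.comp (ρ x.out⁻¹)).smulRight (ρ x.out v₁)
  have hT (v₁ v : V) : T v₁ v = ∑ x : G ⧸ U, Λ (ρ x.out⁻¹ v) • ρ x.out v₁ := by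
    simp [T, LinearMap.sum_apply]
  have hout (v₁ : V) (hv₁ : v₁ ∈ X) (v : V) (g : G) :
      Λ (ρ (g : G ⧸ U).out⁻¹ v) • ρ (g : G ⧸ U).out v₁ = Λ (ρ g⁻¹ v) • ρ g v₁ := by
    obtain ⟨u, hu⟩ := QuotientGroup.mk_out_eq_mul U g
    rw [hu, mul_inv_rev, ← hmul, ← hmul, (hX v₁).1 hv₁, ← Subgroup.coe_inv, h2, map_smul, smul_smul,
      mul_right_comm, hχ, one_mul]
  have hTe (v₁ : V) (hv₁ : v₁ ∈ X) (h : G) (v : V) : T v₁ (ρ h v) = ρ h (T v₁ v) := by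
    rw [hT, hT, map_sum, ← Equiv.sum_comp (MulAction.toPerm h)]
    refine Finset.sum_congr rfl fun x _ => ?_
    induction x using QuotientGroup.induction_on with
    | H g =>
      change Λ (ρ ((h * g : G) : G ⧸ U).out⁻¹ (ρ h v)) • ρ ((h * g : G) : G ⧸ U).out v₁ = _
      rw [hout v₁ hv₁, hout v₁ hv₁, map_smul, hmul, hmul]
      simp [mul_assoc]
  have hne (x : G ⧸ U) (hx : x ≠ ((1 : G) : G ⧸ U)) : x.out ∉ U := fun hmem => hx <| by
    rw [← QuotientGroup.out_eq' x, eq_comm, QuotientGroup.eq]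
    simpa using hmem
  have hv₀ : v₀ ∈ X := (hX v₀).2 h1
  have hT0 (v₁ : V) (hv₁ : v₁ ∈ X) : T v₁ v₀ = v₁ := by
    rw [hT, Finset.sum_eq_single ((1 : G) : G ⧸ U)]
    · rw [hout v₁ hv₁]
      simp [h3]
    · intro x _ hx
      rw [h4 _ fun hmem => hne x hx (by simpa using hmem), zero_smul]
    · simp
  have hΛT (v : V) : Λ (T v₀ v) = Λ v := by
    rw [hT, map_sum, Finset.sum_eq_single ((1 : G) : G ⧸ U)]
    · rw [hout v₀ hv₀]
      simp [h3]
    · intro x _ hx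
      rw [map_smul, h4 _ (hne x hx), smul_zero]
    · simp
  have hTid (v : V) : T v₀ v = v := by
    rw [← sub_eq_zero]
    refine h5 _ fun g => ?_
    rw [map_sub, map_sub, ← hTe v₀ hv₀, hΛT, sub_self]
  let ev : Representation.IntertwiningMap ρ ρ →ₗ[ℂ] X :=
    { toFun f := ⟨f v₀, (hX _).2 fun u => by rw [← f.isIntertwining, h1, map_smul]⟩
      map_add' _ _ := rfl
      map_smul' _ _ := rfl }
  refine ⟨LinearEquiv.ofBijective ev ⟨?_, ?_⟩⟩
  · rw [injective_iff_map_eq_zero]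
    intro f hf
    have hf0 : f v₀ = 0 := congrArg Subtype.val hf
    ext v
    change f v = 0
    rw [← hTid v, hT, map_sum]
    refine Finset.sum_eq_zero fun x _ => ?_
    rw [map_smul, f.isIntertwining, hf0, map_zero, smul_zero]
  · rintro ⟨v₁, hv₁⟩
    exact ⟨(T v₁).intertwiningMap_of_isIntertwiningMap ρ ρ (hTe v₁ hv₁), Subtype.ext (hT0 v₁ hv₁)⟩

/-- The matrix `diag(s, s⁻¹)`. -/
def diagSL {k : Type*} [CommRing k] (s : kˣ) : SL(2, k) :=
  ⟨!![(s : k), 0; 0, ((s⁻¹ : kˣ) : k)], by simp [Matrix.det_fin_two]⟩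

section Matrices

variable {k : Type*} [CommRing k]

lemma coe_upperUnipotent (x : k) :
    (upperUnipotent x : Matrix (Fin 2) (Fin 2) k) = !![1, x; 0, 1] := rfl

lemma coe_diagSL (s : kˣ) :
    (diagSL s : Matrix (Fin 2) (Fin 2) k) = !![(s : k), 0; 0, ((s⁻¹ : kˣ) : k)] := rfl

lemma upperUnipotent_add (x y : k) :
    upperUnipotent (x + y) = upperUnipotent x * upperUnipotent y := by
  ext i j
  fin_cases i <;> fin_cases j <;> simp [coe_upperUnipotent, Matrix.mul_apply, add_comm]

lemma upperUnipotent_zero : upperUnipotent (0 : k) = 1 := by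
  ext i j
  fin_cases i <;> fin_cases j <;> simp [coe_upperUnipotent]

lemma diagSL_one : diagSL (1 : kˣ) = 1 := by
  ext i j
  fin_cases i <;> fin_cases j <;> simp [coe_diagSL]

lemma diagSL_mul_upperUnipotent (s : kˣ) (x : k) :
    diagSL s * upperUnipotent x = upperUnipotent ((s : k) ^ 2 * x) * diagSL s := by
  ext i j
  fin_cases i <;> fin_cases j <;> simp [coe_diagSL, coe_upperUnipotent, Matrix.mul_apply]
  rw [mul_right_comm, sq, mul_assoc (s : k), Units.mul_inv, mul_one]

end Matrices

section Irreducible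

variable {G W : Type*} [Group G] [AddCommGroup W] [Module ℂ W] {σ : Representation ℂ G W}

lemma span_orbit_eq_top (hσ : σ.IsIrreducible) {v : W} (hv : v ≠ 0) :
    Submodule.span ℂ (Set.range fun g => σ g v) = ⊤ := by
  let S : Subrepresentation σ :=
    { toSubmodule := Submodule.span ℂ (Set.range fun g => σ g v)
      apply_mem_toSubmodule := fun g w hw => by
        induction hw using Submodule.span_induction with
        | mem w hw =>
          obtain ⟨h, rfl⟩ := hw
          exact Submodule.subset_span ⟨g * h, by simp⟩
        | zero => simp
        | add x y _ _ hx hy => rw [map_add]; exact Submodule.add_mem _ hx hy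
        | smul c x _ hx => rw [map_smul]; exact Submodule.smul_mem _ c hx }
  rcases hσ.eq_bot_or_eq_top S with h | h
  · have hvS : v ∈ S.toSubmodule := Submodule.subset_span ⟨1, by simp⟩
    rw [h] at hvS
    exact absurd hvS hv
  · exact congrArg Subrepresentation.toSubmodule h

lemma nontrivial_of_isIrreducible (hσ : σ.IsIrreducible) : Nontrivial W := by
  by_contra h
  rw [not_nontrivial_iff_subsingleton] at h
  have := hσ.toNontrivial
  obtain ⟨S, T, hST⟩ := exists_pair_ne (Subrepresentation σ)
  exact hST (Subrepresentation.toSubmodule_injective (Subsingleton.elim _ _))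

lemma finiteDimensional_of_isIrreducible [Finite G] (hσ : σ.IsIrreducible) :
    FiniteDimensional ℂ W := by
  have := nontrivial_of_isIrreducible hσ
  obtain ⟨v, hv⟩ := exists_ne (0 : W)
  exact ⟨by rw [← span_orbit_eq_top hσ hv]; exact Submodule.fg_span (Set.finite_range _)⟩

end Irreducible

section FiniteField

variable {k : Type*} [Field k]

lemma addChar_neg_mul (χ : AddChar k ℂ) (x : k) : χ (-x) * χ x = 1 := by
  rw [← χ.map_add_eq_mul, neg_add_cancel, χ.map_zero_eq_one]

/-- The anti-involution exchanging the diagonal entries. -/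
def diagSwap (g : SL(2, k)) : SL(2, k) :=
  ⟨!![g 1 1, g 0 1; g 1 0, g 0 0], by
    have h := g.det_coe
    rw [Matrix.det_fin_two] at h
    rw [Matrix.det_fin_two_of]
    linear_combination h⟩

lemma coe_diagSwap (g : SL(2, k)) :
    (diagSwap g : Matrix (Fin 2) (Fin 2) k) = !![g 1 1, g 0 1; g 1 0, g 0 0] := rfl

lemma diagSwap_mul (g h : SL(2, k)) : diagSwap (g * h) = diagSwap h * diagSwap g := by
  ext i j
  fin_cases i <;> fin_cases j <;>
    simp [coe_diagSwap, Matrix.mul_apply] <;> ring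

lemma diagSwap_upperUnipotent (x : k) : diagSwap (upperUnipotent x) = upperUnipotent x := by
  ext i j
  fin_cases i <;> fin_cases j <;> simp [coe_diagSwap, coe_upperUnipotent]

lemma addChar_eq_one_of_mul_eq {χ : AddChar k ℂ} (hχ : χ ≠ 1) {a : k}
    (h : ∀ x, χ (a * x) = χ x) : a = 1 := by
  by_contra ha
  refine AddChar.IsPrimitive.of_ne_one hχ (sub_ne_zero.2 ha) ?_
  ext x
  rw [AddChar.mulShift_apply, sub_mul, one_mul, sub_eq_add_neg, χ.map_add_eq_mul, h, mul_comm,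
    addChar_neg_mul, AddChar.one_apply]

variable {W : Type*} [Fintype k] [AddCommGroup W] [Module ℂ W]
  (σ : Representation ℂ SL(2, k) W)

/-- The projection of a representation of `SL(2, k)` onto the `χ`-eigenspace of the group of upper
unipotent matrices. -/
noncomputable def unipotentProj (χ : AddChar k ℂ) : Module.End ℂ W :=
  (Fintype.card k : ℂ)⁻¹ • ∑ x : k, χ (-x) • σ (upperUnipotent x)

lemma unipotentProj_apply (χ : AddChar k ℂ) (w : W) : unipotentProj σ χ w =
    (Fintype.card k : ℂ)⁻¹ • ∑ x : k, χ (-x) • σ (upperUnipotent x) w := by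
  simp [unipotentProj, LinearMap.sum_apply]

lemma upperUnipotent_unipotentProj (χ : AddChar k ℂ) (y : k) (w : W) :
    σ (upperUnipotent y) (unipotentProj σ χ w) = χ y • unipotentProj σ χ w := by
  rw [unipotentProj_apply, map_smul, map_sum, smul_comm (χ y), Finset.smul_sum (r := χ y)]
  congr 1
  refine Fintype.sum_equiv (Equiv.addLeft y) _ _ fun x => ?_
  rw [map_smul, ← Module.End.mul_apply, ← map_mul, ← upperUnipotent_add, smul_smul,
    Equiv.coe_addLeft, ← χ.map_add_eq_mul]
  simp

lemma unipotentProj_upperUnipotent (χ : AddChar k ℂ) (y : k) (w : W) :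
    unipotentProj σ χ (σ (upperUnipotent y) w) = χ y • unipotentProj σ χ w := by
  rw [← upperUnipotent_unipotentProj, unipotentProj_apply, unipotentProj_apply, map_smul, map_sum]
  congr 1
  refine Finset.sum_congr rfl fun x _ => ?_
  rw [map_smul, ← Module.End.mul_apply, ← Module.End.mul_apply, ← map_mul, ← map_mul,
    ← upperUnipotent_add, ← upperUnipotent_add, add_comm]

lemma unipotentProj_of_eigen (χ : AddChar k ℂ) {w : W}
    (hw : ∀ x, σ (upperUnipotent x) w = χ x • w) : unipotentProj σ χ w = w := by
  simp [unipotentProj_apply, hw, smul_smul, addChar_neg_mul, ← Nat.cast_smul_eq_nsmul ℂ]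

lemma unipotentProj_idem (χ : AddChar k ℂ) (w : W) :
    unipotentProj σ χ (unipotentProj σ χ w) = unipotentProj σ χ w :=
  unipotentProj_of_eigen σ χ fun x => upperUnipotent_unipotentProj σ χ x w

lemma sum_unipotentProj (w : W) : ∑ χ : AddChar k ℂ, unipotentProj σ χ w = w := by
  classical
  simp_rw [unipotentProj_apply, ← Finset.smul_sum]
  rw [Finset.sum_comm]
  simp_rw [← Finset.sum_smul, AddChar.sum_apply_eq_ite, neg_eq_zero, ite_smul, zero_smul]
  simp [upperUnipotent_zero, smul_smul]

/-- The operator `e σ(g) e`, where `e` is the projection to the `χ`-eigenspace. -/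
noncomputable def heckeOp (χ : AddChar k ℂ) (g : SL(2, k)) : Module.End ℂ W :=
  unipotentProj σ χ * σ g * unipotentProj σ χ

lemma heckeOp_apply (χ : AddChar k ℂ) (g : SL(2, k)) (w : W) :
    heckeOp σ χ g w = unipotentProj σ χ (σ g (unipotentProj σ χ w)) := rfl

lemma heckeOp_upperUnipotent_mul (χ : AddChar k ℂ) (x : k) (g : SL(2, k)) :
    heckeOp σ χ (upperUnipotent x * g) = χ x • heckeOp σ χ g := by
  ext w
  simp [heckeOp_apply, unipotentProj_upperUnipotent]

lemma heckeOp_mul_upperUnipotent (χ : AddChar k ℂ) (x : k) (g : SL(2, k)) :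
    heckeOp σ χ (g * upperUnipotent x) = χ x • heckeOp σ χ g := by
  ext w
  simp [heckeOp_apply, upperUnipotent_unipotentProj]

lemma heckeOp_mul (χ : AddChar k ℂ) (g h : SL(2, k)) : heckeOp σ χ g * heckeOp σ χ h =
    (Fintype.card k : ℂ)⁻¹ • ∑ x : k, χ (-x) • heckeOp σ χ (g * upperUnipotent x * h) := by
  ext w
  simp [heckeOp_apply, unipotentProj_idem, LinearMap.sum_apply]
  rw [unipotentProj_apply σ χ (σ h _)]
  simp

lemma heckeOp_eq_zero {χ : AddChar k ℂ} (hχ : χ ≠ 1) {g : SL(2, k)} (hc : g 1 0 = 0)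
    (hg : g 0 0 ≠ g 1 1) : heckeOp σ χ g = 0 := by
  by_contra h
  have hdet := g.det_coe
  rw [Matrix.det_fin_two, hc, mul_zero, sub_zero] at hdet
  have key (x : k) : χ (g 0 0 ^ 2 * x) = χ x := by
    have : upperUnipotent (g 0 0 ^ 2 * x) * g = g * upperUnipotent x := by
      ext i j
      fin_cases i <;> fin_cases j <;>
        simp [coe_upperUnipotent, Matrix.mul_apply, hc]
      linear_combination g 0 0 * x * hdet
    have h2 := congrArg (heckeOp σ χ) this
    rw [heckeOp_upperUnipotent_mul, heckeOp_mul_upperUnipotent] at h2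
    exact smul_left_injective ℂ h h2
  have h1 := addChar_eq_one_of_mul_eq hχ key
  refine hg ?_
  linear_combination g 1 1 * h1 - g 0 0 * hdet

lemma heckeOp_diagSwap {χ : AddChar k ℂ} (hχ : χ ≠ 1) (g : SL(2, k)) :
    heckeOp σ χ (diagSwap g) = heckeOp σ χ g := by
  have hdet := g.det_coe
  rw [Matrix.det_fin_two] at hdet
  by_cases hc : g 1 0 = 0
  · by_cases hg : g 0 0 = g 1 1
    · congr 1
      ext i j
      fin_cases i <;> fin_cases j <;> simp [coe_diagSwap, hg]
    · rw [heckeOp_eq_zero σ hχ hc hg, heckeOp_eq_zero σ hχ (g := diagSwap g) hc fun h => hg h.symm]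
  · have : diagSwap g = upperUnipotent ((g 1 1 - g 0 0) / g 1 0) * g *
        upperUnipotent (-((g 1 1 - g 0 0) / g 1 0)) := by
      ext i j
      fin_cases i <;> fin_cases j <;>
        simp [coe_diagSwap, coe_upperUnipotent, Matrix.mul_apply, Matrix.vecMul, dotProduct,
          Fin.sum_univ_two] <;> field_simp <;> ring
    rw [this, heckeOp_mul_upperUnipotent, heckeOp_upperUnipotent_mul, smul_smul, addChar_neg_mul,
      one_smul]

lemma heckeOp_comm {χ : AddChar k ℂ} (hχ : χ ≠ 1) (g h : SL(2, k)) :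
    heckeOp σ χ g * heckeOp σ χ h = heckeOp σ χ h * heckeOp σ χ g := by
  rw [heckeOp_mul, ← heckeOp_diagSwap σ hχ g, ← heckeOp_diagSwap σ hχ h, heckeOp_mul]
  congr 1
  refine Finset.sum_congr rfl fun x _ => ?_
  rw [← heckeOp_diagSwap σ hχ (g * _ * h), diagSwap_mul, diagSwap_mul, diagSwap_upperUnipotent,
    mul_assoc]

variable {σ}

lemma exists_heckeOp_eq_smul (hσ : σ.IsIrreducible) {χ : AddChar k ℂ} (hχ : χ ≠ 1) {v : W}
    (hv : v ≠ 0) (hv' : unipotentProj σ χ v = v) (g : SL(2, k)) :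
    ∃ μ : ℂ, heckeOp σ χ g = μ • unipotentProj σ χ := by
  have := finiteDimensional_of_isIrreducible hσ
  let E := LinearMap.range (unipotentProj σ χ)
  have hmaps : Set.MapsTo (heckeOp σ χ g) E E := fun w _ => ⟨_, (heckeOp_apply σ χ g w).symm⟩
  have : Nontrivial E := ⟨⟨v, v, hv'⟩, 0, fun h => hv (congrArg Subtype.val h)⟩
  obtain ⟨μ, hμ⟩ := Module.End.exists_eigenvalue ((heckeOp σ χ g).restrict hmaps)
  obtain ⟨⟨w, hwE⟩, hw⟩ := hμ.exists_hasEigenvector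
  have hw0 : w ≠ 0 := fun h => hw.2 (Subtype.ext h)
  have hwμ : heckeOp σ χ g w = μ • w := congrArg Subtype.val hw.apply_eq_smul
  have hwe : unipotentProj σ χ w = w := by
    obtain ⟨u, rfl⟩ := hwE
    exact unipotentProj_idem σ χ u
  refine ⟨μ, LinearMap.ext_on_range (span_orbit_eq_top hσ hw0) fun h => ?_⟩
  have h1 : unipotentProj σ χ (σ h w) = heckeOp σ χ h w := by rw [heckeOp_apply, hwe]
  have h2 : heckeOp σ χ g (σ h w) = heckeOp σ χ g (heckeOp σ χ h w) := by
    rw [← h1, heckeOp_apply, heckeOp_apply, unipotentProj_idem]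
  rw [h2, LinearMap.smul_apply, h1, ← Module.End.mul_apply, heckeOp_comm σ hχ, Module.End.mul_apply,
    hwμ, map_smul]

lemma unipotentProj_mem_span (hσ : σ.IsIrreducible) {χ : AddChar k ℂ} (hχ : χ ≠ 1) {v : W}
    (hv : v ≠ 0) (hv' : unipotentProj σ χ v = v) (w : W) :
    unipotentProj σ χ w ∈ Submodule.span ℂ {v} := by
  have hw : w ∈ Submodule.span ℂ (Set.range fun g => σ g v) := by
    rw [span_orbit_eq_top hσ hv]
    trivial
  induction hw using Submodule.span_induction with
  | mem w hw =>
    obtain ⟨g, rfl⟩ := hw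
    obtain ⟨μ, hμ⟩ := exists_heckeOp_eq_smul hσ hχ hv hv' g
    have h := heckeOp_apply σ χ g v
    rw [hv', hμ, LinearMap.smul_apply, hv'] at h
    exact h ▸ Submodule.smul_mem _ _ (Submodule.mem_span_singleton_self v)
  | zero => simp
  | add x y _ _ hx hy => rw [map_add]; exact Submodule.add_mem _ hx hy
  | smul c x _ hx => rw [map_smul]; exact Submodule.smul_mem _ c hx

lemma exists_mulShift_eq {ψ : AddChar k ℂ} (hψ : ψ ≠ 1) (χ : AddChar k ℂ) :
    ∃ a, ψ.mulShift a = χ :=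
  ((Fintype.bijective_iff_injective_and_card _).2
    ⟨AddChar.to_mulShift_inj_of_isPrimitive (AddChar.IsPrimitive.of_ne_one hψ),
      AddChar.card_eq.symm⟩).2 χ

lemma unipotentProj_diagSL (ψ : AddChar k ℂ) (s : kˣ) (w : W) :
    unipotentProj σ ψ (σ (diagSL s) w) =
      σ (diagSL s) (unipotentProj σ (ψ.mulShift ((s : k) ^ 2)) w) := by
  rw [unipotentProj_apply, unipotentProj_apply, map_smul, map_sum]
  congr 1
  rw [← Equiv.sum_comp (Units.mulLeft (s ^ 2))]
  refine Finset.sum_congr rfl fun x _ => ?_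
  rw [map_smul, ← Module.End.mul_apply, ← Module.End.mul_apply, ← map_mul, ← map_mul,
    diagSL_mul_upperUnipotent]
  simp

end FiniteField

/-- `w₀` spans the `ψ`-eigenspace of the upper unipotent group, `lam` is the corresponding
coordinate, and the translates of `lam` under the diagonal torus separate points. -/
structure IsWhittaker {k W : Type*} [Field k] [AddCommGroup W] [Module ℂ W]
    (σ : Representation ℂ SL(2, k) W) (ψ : AddChar k ℂ) (w₀ : W) (lam : W →ₗ[ℂ] ℂ) : Prop where
  ne_one : ψ ≠ 1
  lam_vec : lam w₀ = 1
  vec_eigen : ∀ x, σ (upperUnipotent x) w₀ = ψ x • w₀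
  lam_eigen : ∀ x w, lam (σ (upperUnipotent x) w) = ψ x * lam w
  eq_smul : ∀ w, (∀ x, σ (upperUnipotent x) w = ψ x • w) → w = lam w • w₀
  eq_zero : ∀ w, (∀ s, lam (σ (diagSL s) w) = 0) → w = 0

/-- A cuspidal representation of `SL(2, k)` in characteristic two has a one-dimensional Whittaker
space, whose translates under the diagonal torus generate it. -/
theorem IsCuspidal.exists_isWhittaker {k W : Type*} [Field k] [Finite k] [CharP k 2]
    [AddCommGroup W] [Module ℂ W] {σ : Representation ℂ SL(2, k) W} (hσ : IsCuspidal σ) :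
    ∃ (ψ : AddChar k ℂ) (w₀ : W) (lam : W →ₗ[ℂ] ℂ), IsWhittaker σ ψ w₀ lam := by
  have : Fintype k := Fintype.ofFinite k
  have := nontrivial_of_isIrreducible hσ.irreducible
  have hone (w : W) : unipotentProj σ 1 w = 0 :=
    hσ.no_fixed_vector _ fun x => by rw [upperUnipotent_unipotentProj]; simp
  obtain ⟨ψ, v, hv⟩ : ∃ (ψ : AddChar k ℂ) (v : W), unipotentProj σ ψ v ≠ 0 := by
    by_contra! h
    obtain ⟨v, hv⟩ := exists_ne (0 : W)
    exact hv (by rw [← sum_unipotentProj σ v]; exact Finset.sum_eq_zero fun χ _ => h χ v)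
  have hψ : ψ ≠ 1 := by
    rintro rfl
    exact hv (hone v)
  set w₀ := unipotentProj σ ψ v with hw₀
  have hw₀' : unipotentProj σ ψ w₀ = w₀ := unipotentProj_idem σ ψ v
  have hspan := unipotentProj_mem_span hσ.irreducible hψ hv hw₀'
  obtain ⟨f, hf⟩ := Module.Projective.exists_dual_eq_one ℂ hv
  have hfe (w : W) : unipotentProj σ ψ w = f (unipotentProj σ ψ w) • w₀ := by
    obtain ⟨c, hc⟩ := Submodule.mem_span_singleton.1 (hspan w)
    rw [← hc, map_smul, hf, smul_eq_mul, mul_one]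
  refine ⟨ψ, w₀, f.comp (unipotentProj σ ψ), hψ, ?_,
    fun x => upperUnipotent_unipotentProj σ ψ x v, ?_, ?_, ?_⟩
  · rw [LinearMap.comp_apply, hw₀', hf]
  · intro x w
    rw [LinearMap.comp_apply, unipotentProj_upperUnipotent, map_smul, smul_eq_mul,
      LinearMap.comp_apply]
  · intro w hw
    rw [LinearMap.comp_apply, ← hfe, unipotentProj_of_eigen σ ψ hw]
  · intro w hw
    rw [← sum_unipotentProj σ w]
    refine Finset.sum_eq_zero fun χ _ => ?_
    obtain ⟨a, rfl⟩ := exists_mulShift_eq hψ χ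
    by_cases ha : a = 0
    · rw [ha, AddChar.mulShift_zero, hone]
    · obtain ⟨b, rfl⟩ := FiniteField.isSquare_of_char_two (ringChar.eq k 2) a
      have hb : b ≠ 0 := fun h => ha (by simp [h])
      have h := hfe (σ (diagSL (Units.mk0 b hb)) w)
      have h' : f (unipotentProj σ ψ (σ (diagSL (Units.mk0 b hb)) w)) = 0 := hw _
      rw [h', zero_smul, unipotentProj_diagSL] at h
      have h2 := congrArg (σ (diagSL (Units.mk0 b hb))⁻¹) h
      rwa [← Module.End.mul_apply, ← map_mul, inv_mul_cancel, map_one, map_zero, Units.val_mk0,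
        Module.End.one_apply, sq] at h2

section DVR

open IsLocalRing

/-- The reduction of `R ⧸ 𝔪 ^ (n + 1)` to the residue field. -/
noncomputable def quotResidue (R : Type*) [CommRing R] [IsLocalRing R] (n : ℕ) :
    R ⧸ maximalIdeal R ^ (n + 1) →+* ResidueField R :=
  Ideal.Quotient.lift _ (residue R) fun _ ha =>
    (residue_eq_zero_iff _).2 (Ideal.pow_le_self (Nat.succ_ne_zero n) ha)

lemma quotResidue_mk {R : Type*} [CommRing R] [IsLocalRing R] (n : ℕ) (a : R) :
    quotResidue R n (Ideal.Quotient.mk _ a) = residue R a := rfl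

variable {R : Type*} [CommRing R] [IsDomain R] [IsDiscreteValuationRing R]

lemma mem_maximalIdeal_pow_iff {ϖ : R} (hϖ : Irreducible ϖ) {n : ℕ} {x : R} :
    x ∈ maximalIdeal R ^ n ↔ ϖ ^ n ∣ x := by
  rw [hϖ.maximalIdeal_eq, Ideal.span_singleton_pow, Ideal.mem_span_singleton]

lemma residue_eq_iff_dvd_sub {ϖ : R} (hϖ : Irreducible ϖ) {x y : R} :
    residue R x = residue R y ↔ ϖ ∣ x - y := by
  rw [← pow_one ϖ, ← mem_maximalIdeal_pow_iff hϖ, pow_one]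
  exact Ideal.Quotient.eq

lemma residue_uniformizer {ϖ : R} (hϖ : Irreducible ϖ) : residue R ϖ = 0 := by
  rw [residue_eq_zero_iff, hϖ.maximalIdeal_eq]
  exact Ideal.mem_span_singleton_self ϖ

lemma mk_uniformizer_pow_mul_congr {ϖ : R} (hϖ : Irreducible ϖ) (n : ℕ) {b c : R}
    (h : residue R b = residue R c) : Ideal.Quotient.mk (maximalIdeal R ^ (n + 1)) (ϖ ^ n * b) =
      Ideal.Quotient.mk (maximalIdeal R ^ (n + 1)) (ϖ ^ n * c) := by
  rw [Ideal.Quotient.eq, mem_maximalIdeal_pow_iff hϖ, ← mul_sub, pow_succ]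
  exact mul_dvd_mul_left _ ((residue_eq_iff_dvd_sub hϖ).1 h)

lemma isUnit_iff_quotResidue_ne_zero (n : ℕ) (c : R ⧸ maximalIdeal R ^ (n + 1)) :
    IsUnit c ↔ quotResidue R n c ≠ 0 := by
  refine ⟨fun h => (h.map (quotResidue R n)).ne_zero, fun h => ?_⟩
  obtain ⟨r, rfl⟩ := Ideal.Quotient.mk_surjective c
  rw [quotResidue_mk, residue_ne_zero_iff_isUnit] at h
  exact h.map _

lemma eq_one_of_sq_eq_one [CharP (ResidueField R) 2] {x : ResidueField R} (h : x ^ 2 = 1) : x = 1 := by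
  have : (x - 1) ^ 2 = 0 := by rw [sub_pow_char, h]; simp
  exact sub_eq_zero.1 (pow_eq_zero_iff two_ne_zero |>.1 this)

variable [Finite (ResidueField R)]

instance finite_quotient_maximalIdeal_pow (n : ℕ) : Finite (R ⧸ maximalIdeal R ^ n) := by
  have : Finite (R ⧸ maximalIdeal R) := inferInstanceAs (Finite (ResidueField R))
  exact Ideal.finite_quotient_pow (IsNoetherian.noetherian _) n

/-- Every nontrivial additive character of the residue field, placed on the socle of
`R ⧸ 𝔪 ^ (n + 1)`, extends to a generating character of this ring. -/
lemma exists_generating_addChar {ϖ : R} (hϖ : Irreducible ϖ) (n : ℕ)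
    {ψ : AddChar (ResidueField R) ℂ} (hψ : ψ ≠ 1) :
    ∃ η : AddChar (R ⧸ maximalIdeal R ^ (n + 1)) ℂ, η.IsPrimitive ∧
      ∀ b, η (Ideal.Quotient.mk _ (ϖ ^ n * b)) = ψ (residue R b) := by
  classical
  have : Fintype (ResidueField R) := Fintype.ofFinite _
  have hne : Ideal.Quotient.mk (maximalIdeal R ^ (n + 1)) (ϖ ^ n) ≠ 0 := by
    rw [Ne, Ideal.Quotient.eq_zero_iff_mem, mem_maximalIdeal_pow_iff hϖ,
      pow_dvd_pow_iff hϖ.ne_zero hϖ.not_isUnit]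
    omega
  obtain ⟨η₁, hη₁⟩ := AddChar.exists_apply_ne_zero.2 hne
  let lift := Function.surjInv (residue_surjective (R := R))
  have hlift (x) : residue R (lift x) = x := Function.surjInv_eq _ x
  let χ : AddChar (ResidueField R) ℂ :=
    { toFun x := η₁ (Ideal.Quotient.mk _ (ϖ ^ n * lift x))
      map_zero_eq_one' := by
        rw [mk_uniformizer_pow_mul_congr hϖ n (c := 0) (by rw [hlift, map_zero]), mul_zero, map_zero,
          η₁.map_zero_eq_one]
      map_add_eq_mul' x y := by
        rw [← η₁.map_add_eq_mul, ← map_add, ← mul_add,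
          mk_uniformizer_pow_mul_congr hϖ n (c := lift x + lift y) (by simp [hlift])] }
  have hχ' (b : R) : χ (residue R b) = η₁ (Ideal.Quotient.mk _ (ϖ ^ n * b)) := by
    change η₁ _ = _
    rw [mk_uniformizer_pow_mul_congr hϖ n (hlift _)]
  have hχ : χ ≠ 1 := by
    intro h
    apply hη₁
    have h1 := hχ' 1
    rw [mul_one, h, AddChar.one_apply] at h1
    exact h1.symm
  obtain ⟨a, ha⟩ := exists_mulShift_eq hχ ψ
  obtain ⟨a, rfl⟩ := residue_surjective a
  have hη (b) : η₁.mulShift (Ideal.Quotient.mk _ a) (Ideal.Quotient.mk _ (ϖ ^ n * b)) =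
      ψ (residue R b) := by
    rw [AddChar.mulShift_apply, ← map_mul, mul_left_comm, ← hχ', map_mul, ← ha,
      AddChar.mulShift_apply]
  refine ⟨_, fun c hc h => hψ ?_, hη⟩
  obtain ⟨r, rfl⟩ := Ideal.Quotient.mk_surjective c
  have hr : r ≠ 0 := fun h => hc (by rw [h, map_zero])
  obtain ⟨i, u, rfl⟩ := IsDiscreteValuationRing.eq_unit_mul_pow_irreducible hr hϖ
  rw [Ne, Ideal.Quotient.eq_zero_iff_mem, mem_maximalIdeal_pow_iff hϖ] at hc
  have hi : i ≤ n := by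
    by_contra hi
    exact hc (Dvd.dvd.mul_left (pow_dvd_pow ϖ (by omega)) _)
  ext x
  obtain ⟨b, rfl⟩ := residue_surjective x
  rw [← hη, AddChar.one_apply]
  have h2 := DFunLike.congr_fun h
    (Ideal.Quotient.mk _ (((u⁻¹ : Rˣ) : R) * ϖ ^ (n - i) * b))
  rw [AddChar.mulShift_apply, ← map_mul, AddChar.one_apply] at h2
  rw [← h2]
  congr 2
  rw [show (u : R) * ϖ ^ i * (((u⁻¹ : Rˣ) : R) * ϖ ^ (n - i) * b) =
    (u * ((u⁻¹ : Rˣ) : R)) * (ϖ ^ i * ϖ ^ (n - i)) * b by ring, Units.mul_inv, ← pow_add,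
    Nat.add_sub_cancel' hi, one_mul]

/-- The functions on `R` which transform by `ψ` under translation by `ϖ ^ n R` and are invariant
under multiplication by squares of principal units. -/
def equivariantFun (ϖ : R) (n : ℕ) (ψ : AddChar (ResidueField R) ℂ) : Submodule ℂ (R → ℂ) where
  carrier := {φ | (∀ y b, φ (y + ϖ ^ n * b) = ψ (residue R b) * φ y) ∧
    ∀ a, residue R a = 1 → ∀ y, φ (a ^ 2 * y) = φ y}
  add_mem' hf hg := ⟨fun y b => by simp [hf.1, hg.1, mul_add],
    fun a ha y => by simp [hf.2 a ha, hg.2 a ha]⟩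
  zero_mem' := by simp
  smul_mem' c f hf := ⟨fun y b => by simp [hf.1, mul_left_comm], fun a ha y => by simp [hf.2 a ha]⟩

/-- The square classes of a commutative group. -/
abbrev GroupSquareClasses (Q : Type*) [CommGroup Q] : Type _ :=
  Q ⧸ (powMonoidHom 2 : Q →* Q).range

/-- The functions on `R ⧸ 𝔪 ^ (n + 1)` supported on the principal units and invariant under
multiplication by their squares. -/
noncomputable def squareInvariantFun (R : Type*) [CommRing R] [IsLocalRing R] (n : ℕ) :
    Submodule ℂ (R ⧸ maximalIdeal R ^ (n + 1) → ℂ) where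
  carrier := {h | (∀ c, quotResidue R n c ≠ 1 → h c = 0) ∧
    ∀ v : (R ⧸ maximalIdeal R ^ (n + 1))ˣ, quotResidue R n v = 1 → ∀ c, h (v ^ 2 * c) = h c}
  add_mem' hf hg := ⟨fun c hc => by simp [hf.1 c hc, hg.1 c hc],
    fun a ha y => by simp [hf.2 a ha, hg.2 a ha]⟩
  zero_mem' := by simp
  smul_mem' c f hf := ⟨fun y hy => by simp [hf.1 y hy], fun a ha y => by simp [hf.2 a ha]⟩

lemma nonempty_squareInvariantFun_equiv_equivariantFun {ϖ : R} (hϖ : Irreducible ϖ) (n : ℕ)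
    {ψ : AddChar (ResidueField R) ℂ} (hψ : ψ ≠ 1) :
    Nonempty (squareInvariantFun R n ≃ₗ[ℂ] equivariantFun ϖ n ψ) := by
  classical
  have : Fintype (R ⧸ maximalIdeal R ^ (n + 1)) := Fintype.ofFinite _
  obtain ⟨η, hη, hηψ⟩ := exists_generating_addChar hϖ n hψ
  have hbij : Function.Bijective η.mulShift :=
    (Fintype.bijective_iff_injective_and_card _).2
      ⟨AddChar.to_mulShift_inj_of_isPrimitive hη, AddChar.card_eq.symm⟩
  let B := (AddChar.complexBasis (R ⧸ maximalIdeal R ^ (n + 1))).reindex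
    (Equiv.ofBijective _ hbij).symm
  have hB (h : R ⧸ maximalIdeal R ^ (n + 1) → ℂ) (a : R ⧸ maximalIdeal R ^ (n + 1)) :
      B.equivFun.symm h a = ∑ c, h c * η (c * a) := by
    simp [B, Module.Basis.equivFun_symm_apply]
  have hψ' (c : R ⧸ maximalIdeal R ^ (n + 1)) (b : R) :
      η (c * Ideal.Quotient.mk _ (ϖ ^ n * b)) = ψ (quotResidue R n c * residue R b) := by
    obtain ⟨r, rfl⟩ := Ideal.Quotient.mk_surjective c
    rw [← map_mul, mul_left_comm, hηψ, map_mul, quotResidue_mk]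
  have hunit (a : R) (ha : residue R a = 1) : ∃ v : (R ⧸ maximalIdeal R ^ (n + 1))ˣ,
      (v : R ⧸ maximalIdeal R ^ (n + 1)) = Ideal.Quotient.mk _ a :=
    (isUnit_iff_quotResidue_ne_zero n _).2 (by rw [quotResidue_mk, ha]; exact one_ne_zero)
  have hshift (h : R ⧸ maximalIdeal R ^ (n + 1) → ℂ) (v : (R ⧸ maximalIdeal R ^ (n + 1))ˣ) (a) :
      B.equivFun.symm h a = ∑ c, h (v ^ 2 * c) * η (v ^ 2 * c * a) := by
    rw [hB, ← Equiv.sum_comp (Units.mulLeft (v ^ 2))]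
    simp
  let E : squareInvariantFun R n →ₗ[ℂ] equivariantFun ϖ n ψ :=
    { toFun h := ⟨fun y => B.equivFun.symm h.1 (Ideal.Quotient.mk _ y), fun y b => by
          dsimp only
          rw [hB, hB, Finset.mul_sum]
          refine Finset.sum_congr rfl fun c _ => ?_
          by_cases hc : quotResidue R n c = 1
          · rw [map_add, mul_add, η.map_add_eq_mul, hψ', hc, one_mul]
            ring
          · rw [h.2.1 c hc]
            ring, fun a ha y => by
          obtain ⟨v, hv⟩ := hunit a ha
          dsimp only
          rw [hB, hshift _ v]
          refine Finset.sum_congr rfl fun c _ => ?_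
          rw [h.2.2 v (by rw [hv, quotResidue_mk, ha]), map_mul (Ideal.Quotient.mk _), map_pow, hv, mul_left_comm,
            mul_assoc]⟩
      map_add' _ _ := by
        ext y
        simp [add_mul, Finset.sum_add_distrib]
      map_smul' _ _ := by
        ext y
        simp }
  refine ⟨LinearEquiv.ofBijective E ⟨?_, ?_⟩⟩
  · intro h₁ h₂ hh
    refine Subtype.ext (B.equivFun.symm.injective (funext fun a => ?_))
    obtain ⟨y, rfl⟩ := Ideal.Quotient.mk_surjective a
    exact congrFun (congrArg Subtype.val hh) y
  · rintro ⟨φ, hφ1, hφ2⟩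
    have hcongr (y y' : R) (hy : Ideal.Quotient.mk (maximalIdeal R ^ (n + 1)) y =
        Ideal.Quotient.mk (maximalIdeal R ^ (n + 1)) y') : φ y = φ y' := by
      rw [Ideal.Quotient.eq, mem_maximalIdeal_pow_iff hϖ] at hy
      obtain ⟨c, hc⟩ := hy
      rw [← sub_add_cancel y y', hc, pow_succ, mul_assoc, add_comm, hφ1, map_mul,
        residue_uniformizer hϖ, zero_mul, ψ.map_zero_eq_one, one_mul]
    let φb (a : R ⧸ maximalIdeal R ^ (n + 1)) : ℂ :=
      φ (Function.surjInv Ideal.Quotient.mk_surjective a)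
    have hφb (y : R) : φb (Ideal.Quotient.mk _ y) = φ y := hcongr _ _ (Function.surjInv_eq _ _)
    have hφb1 (a) (b : R) : φb (a + Ideal.Quotient.mk _ (ϖ ^ n * b)) = ψ (residue R b) * φb a := by
      obtain ⟨y, rfl⟩ := Ideal.Quotient.mk_surjective a
      rw [← map_add, hφb, hφb, hφ1]
    have hφb2 (v : (R ⧸ maximalIdeal R ^ (n + 1))ˣ) (hv : quotResidue R n v = 1) (a) :
        φb (v ^ 2 * a) = φb a := by
      obtain ⟨y, rfl⟩ := Ideal.Quotient.mk_surjective a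
      obtain ⟨r, hr⟩ := Ideal.Quotient.mk_surjective (v : R ⧸ maximalIdeal R ^ (n + 1))
      rw [← hr, quotResidue_mk] at hv
      rw [← hr, ← map_pow, ← map_mul, hφb, hφb, hφ2 r hv]
    set h := B.equivFun φb with hh
    have hsymm : B.equivFun.symm h = φb := by rw [hh, LinearEquiv.symm_apply_apply]
    refine ⟨⟨h, fun c hc => ?_, fun v hv c => ?_⟩, Subtype.ext (funext fun y => ?_)⟩
    · by_contra hne
      refine hc (addChar_eq_one_of_mul_eq hψ fun x => ?_)
      obtain ⟨b, rfl⟩ := residue_surjective x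
      have h1 : (fun c => h c * η (c * Ideal.Quotient.mk _ (ϖ ^ n * b))) =
          fun c => ψ (residue R b) * h c := by
        refine B.equivFun.symm.injective (funext fun a => ?_)
        have h2 := hφb1 a b
        rw [← hsymm, hB, hB, Finset.mul_sum] at h2
        rw [hB, hB]
        convert h2 using 2 with c _ c _
        · rw [mul_add, η.map_add_eq_mul]
          ring
        · ring
      have h3 := congrFun h1 c
      rw [hψ', mul_comm] at h3
      exact mul_right_cancel₀ hne h3
    · refine congrFun (B.equivFun.symm.injective (funext fun a => ?_) :
        (fun c => h (v ^ 2 * c)) = h) c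
      rw [hsymm, ← hφb2 v⁻¹ (by
        have := (v⁻¹).isUnit.map (quotResidue R n)
        have h4 : quotResidue R n (v * v⁻¹ : (R ⧸ maximalIdeal R ^ (n + 1))ˣ) = 1 := by simp
        rwa [Units.val_mul, map_mul, hv, one_mul] at h4) a, ← hsymm, hshift h v, hB]
      refine Finset.sum_congr rfl fun c _ => ?_
      rw [← Units.val_pow_eq_pow_val, ← Units.val_pow_eq_pow_val, inv_pow, mul_comm _ c, mul_assoc,
        Units.mul_inv_cancel_left, mul_comm c]
    · change B.equivFun.symm h _ = φ y
      rw [hsymm, hφb]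

section CharTwo

variable [CharP (ResidueField R) 2]

lemma exists_representative_residue_one (n : ℕ)
    (q : GroupSquareClasses (R ⧸ maximalIdeal R ^ (n + 1))ˣ) :
    ∃ c : (R ⧸ maximalIdeal R ^ (n + 1))ˣ, (c : GroupSquareClasses _) = q ∧
      quotResidue R n c = 1 := by
  induction q using QuotientGroup.induction_on with
  | H u =>
    obtain ⟨s, hs⟩ := FiniteField.isSquare_of_char_two (ringChar.eq (ResidueField R) 2)
      (quotResidue R n u)
    obtain ⟨r, rfl⟩ := residue_surjective s
    rw [← quotResidue_mk n, ← map_mul] at hs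
    have hu := (u.isUnit.map (quotResidue R n)).ne_zero
    rw [hs, ← isUnit_iff_quotResidue_ne_zero, IsUnit.mul_iff] at hu
    obtain ⟨v, hv⟩ := hu.1
    rw [← hv] at hs
    refine ⟨u * (v⁻¹) ^ 2, ?_, ?_⟩
    · rw [QuotientGroup.eq]
      exact ⟨v, by simp⟩
    · rw [Units.val_mul, map_mul, hs, ← map_mul, ← Units.val_mul, ← Units.val_mul, ← sq,
        ← mul_pow, mul_inv_cancel, one_pow, Units.val_one, map_one]

lemma nonempty_squareInvariantFun_equiv (n : ℕ) : Nonempty (squareInvariantFun R n ≃ₗ[ℂ]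
    (GroupSquareClasses (R ⧸ maximalIdeal R ^ (n + 1))ˣ → ℂ)) := by
  classical
  choose rep hrep hrep1 using exists_representative_residue_one (R := R) n
  have hmem (h : squareInvariantFun R n) (u v : (R ⧸ maximalIdeal R ^ (n + 1))ˣ)
      (hu : quotResidue R n u = 1) (hv : quotResidue R n v = 1)
      (huv : (u : GroupSquareClasses (R ⧸ maximalIdeal R ^ (n + 1))ˣ) = (v : GroupSquareClasses _)) : h.1 v = h.1 u := by
    rw [QuotientGroup.eq] at huv
    obtain ⟨s, hs⟩ := huv
    have hs' : v = s ^ 2 * u := by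
      rw [show s ^ 2 = u⁻¹ * v from hs, mul_comm, mul_inv_cancel_left]
    have hs1 : quotResidue R n s = 1 := by
      apply eq_one_of_sq_eq_one
      have := congrArg (fun x : (R ⧸ maximalIdeal R ^ (n + 1))ˣ => quotResidue R n x) hs'
      simpa [hu, hv] using this.symm
    rw [hs', Units.val_mul, Units.val_pow_eq_pow_val, h.2.2 s hs1]
  let E : squareInvariantFun R n →ₗ[ℂ]
      (GroupSquareClasses (R ⧸ maximalIdeal R ^ (n + 1))ˣ → ℂ) :=
    { toFun h q := h.1 (rep q)
      map_add' _ _ := rfl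
      map_smul' _ _ := rfl }
  refine ⟨LinearEquiv.ofBijective E ⟨?_, ?_⟩⟩
  · rw [injective_iff_map_eq_zero]
    intro h hh
    ext c
    by_cases hc : quotResidue R n c = 1
    · obtain ⟨u, rfl⟩ := (isUnit_iff_quotResidue_ne_zero n c).2 (by rw [hc]; exact one_ne_zero)
      rw [← hmem h u (rep u) hc (hrep1 _) (hrep _).symm]
      exact congrFun hh u
    · exact h.2.1 c hc
  · intro f
    let h (c : R ⧸ maximalIdeal R ^ (n + 1)) : ℂ :=
      if hc : IsUnit c ∧ quotResidue R n c = 1 then f hc.1.unit else 0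
    have hh (u : (R ⧸ maximalIdeal R ^ (n + 1))ˣ) (hu : quotResidue R n u = 1) : h u = f u := by
      simp only [h, dif_pos (show IsUnit (u : R ⧸ maximalIdeal R ^ (n + 1)) ∧ _ from
        ⟨u.isUnit, hu⟩), IsUnit.unit_of_val_units]
    refine ⟨⟨h, fun c hc => dif_neg fun h' => hc h'.2, fun v hv c => ?_⟩, funext fun q => ?_⟩
    · by_cases hc : quotResidue R n c = 1
      · obtain ⟨u, rfl⟩ := (isUnit_iff_quotResidue_ne_zero n c).2 (by rw [hc]; exact one_ne_zero)
        have hvu : quotResidue R n ((v ^ 2 * u : (R ⧸ maximalIdeal R ^ (n + 1))ˣ) :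
            R ⧸ maximalIdeal R ^ (n + 1)) = 1 := by simp [hv, hc]
        rw [← Units.val_pow_eq_pow_val, ← Units.val_mul, hh _ hvu, hh _ hc]
        congr 1
        rw [QuotientGroup.eq]
        exact ⟨v⁻¹, by simp [mul_comm]⟩
      · simp only [h]
        rw [dif_neg, dif_neg]
        · exact fun h' => hc h'.2
        · rw [map_mul, map_pow, hv, one_pow, one_mul]
          exact fun h' => hc h'.2
    · change h (rep q) = f q
      rw [hh _ (hrep1 q), hrep]

/-- The space of equivariant functions has dimension the number of square classes of units of
`R ⧸ 𝔪 ^ (n + 1)`. -/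
theorem finrank_equivariantFun {ϖ : R} (hϖ : Irreducible ϖ) (n : ℕ)
    {ψ : AddChar (ResidueField R) ℂ} (hψ : ψ ≠ 1) : Module.finrank ℂ (equivariantFun ϖ n ψ) =
      Nat.card (GroupSquareClasses (R ⧸ maximalIdeal R ^ (n + 1))ˣ) := by
  classical
  obtain ⟨E₁⟩ := nonempty_squareInvariantFun_equiv (R := R) n
  obtain ⟨E₂⟩ := nonempty_squareInvariantFun_equiv_equivariantFun hϖ n hψ
  have := Fintype.ofFinite (GroupSquareClasses (R ⧸ maximalIdeal R ^ (n + 1))ˣ)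
  rw [(E₂.symm.trans E₁).finrank_eq, Module.finrank_fintype_fun_eq_card, Nat.card_eq_fintype_card]

end CharTwo

end DVR

lemma card_groupSquareClasses (Q : Type*) [CommGroup Q] [Finite Q] :
    Nat.card (GroupSquareClasses Q) = Nat.card {u : Q // u ^ 2 = 1} := by
  have h1 := (powMonoidHom 2 : Q →* Q).ker.card_mul_index
  rw [Subgroup.index_ker, ← (powMonoidHom 2 : Q →* Q).range.card_mul_index, mul_comm] at h1
  exact (Nat.eq_of_mul_eq_mul_left Nat.card_pos h1).symm

lemma index_range_pow_two_sup_ker {G Q : Type*} [CommGroup G] [CommGroup Q] {f : G →* Q}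
    (hf : Function.Surjective f) :
    ((powMonoidHom 2 : G →* G).range ⊔ f.ker).index = Nat.card (GroupSquareClasses Q) := by
  have h : (powMonoidHom 2 : Q →* Q).range = (powMonoidHom 2 : G →* G).range.map f := by
    ext x
    constructor
    · rintro ⟨y, rfl⟩
      obtain ⟨z, rfl⟩ := hf y
      exact ⟨z ^ 2, ⟨z, rfl⟩, by simp⟩
    · rintro ⟨_, ⟨z, rfl⟩, rfl⟩
      exact ⟨f z, by simp⟩
  rw [← Subgroup.comap_map_eq, ← h, Subgroup.index_comap_of_surjective _ hf]
  rfl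

lemma card_units_sq_eq_one (A : Type*) [CommRing A] :
    Nat.card {u : Aˣ // u ^ 2 = 1} = Nat.card {x : A // x * (x + 2) = 0} := by
  have hsq (x : A) (h : x * (x + 2) = 0) : (x + 1) * (x + 1) = 1 := by linear_combination h
  refine Nat.card_congr
    { toFun u := ⟨u.1 - 1, ?_⟩
      invFun x := ⟨⟨x.1 + 1, x.1 + 1, hsq _ x.2, hsq _ x.2⟩, Units.ext ?_⟩
      left_inv u := ?_
      right_inv x := ?_ }
  · have h : (u.1 : A) ^ 2 = 1 := by
      have := congrArg Units.val u.2
      simpa using this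
    linear_combination h
  · simpa [sq] using hsq _ x.2
  · ext
    simp
  · ext
    simp

section DVR

open IsLocalRing

variable {R : Type*} [CommRing R] [IsDomain R] [IsDiscreteValuationRing R]

lemma card_quotient_maximalIdeal_pow (n : ℕ) :
    Nat.card (R ⧸ maximalIdeal R ^ n) = Nat.card (ResidueField R) ^ n :=
  cardQuot_pow_of_prime (IsDiscreteValuationRing.not_a_field R)

lemma mk_mem_map_maximalIdeal_pow {ϖ : R} (hϖ : Irreducible ϖ) {i n : ℕ} (hi : i ≤ n) (x : R) :
    Ideal.Quotient.mk (maximalIdeal R ^ n) x ∈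
      (maximalIdeal R ^ i).map (Ideal.Quotient.mk (maximalIdeal R ^ n)) ↔ ϖ ^ i ∣ x := by
  rw [Ideal.mem_quotient_iff_mem (Ideal.pow_le_pow_right hi), mem_maximalIdeal_pow_iff hϖ]

lemma pow_dvd_mul_add_two_iff_of_le {ϖ : R} (hϖ : Irreducible ϖ) {n : ℕ}
    (hn : (n : ℕ∞) ≤ 2 * emultiplicity ϖ (2 : R)) (x : R) :
    ϖ ^ n ∣ x * (x + 2) ↔ ϖ ^ ((n + 1) / 2) ∣ x := by
  have hh : ϖ ^ ((n + 1) / 2) ∣ (2 : R) := by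
    rw [pow_dvd_iff_le_emultiplicity]
    generalize emultiplicity ϖ (2 : R) = e at hn
    induction e using ENat.recTopCoe with
    | top => exact le_top
    | coe e =>
      norm_cast at hn ⊢
      omega
  constructor
  · intro h
    by_contra hx
    have hlt : emultiplicity ϖ x < emultiplicity ϖ 2 :=
      (emultiplicity_lt_iff_not_dvd.2 hx).trans_le (pow_dvd_iff_le_emultiplicity.1 hh)
    rw [pow_dvd_iff_le_emultiplicity, emultiplicity_mul hϖ.prime, add_comm x,
      emultiplicity_add_of_gt hlt] at h
    rw [pow_dvd_iff_le_emultiplicity] at hx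
    generalize emultiplicity ϖ x = m at h hx
    induction m using ENat.recTopCoe with
    | top => exact hx le_top
    | coe m =>
      norm_cast at h hx
      omega
  · intro h
    refine (pow_dvd_pow ϖ (by omega : n ≤ (n + 1) / 2 + (n + 1) / 2)).trans ?_
    rw [pow_add]
    exact mul_dvd_mul h (dvd_add h hh)

lemma pow_dvd_mul_add_two_iff_of_lt {ϖ : R} (hϖ : Irreducible ϖ) {n e : ℕ}
    (he : emultiplicity ϖ (2 : R) = e) (hn : 2 * e + 1 ≤ n) (x : R) :
    ϖ ^ n ∣ x * (x + 2) ↔ ϖ ^ (n - e) ∣ x ∨ ϖ ^ (n - e) ∣ x + 2 := by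
  have h2 : ϖ ^ e ∣ (2 : R) := pow_dvd_iff_le_emultiplicity.2 he.ge
  have hle : ϖ ^ e ∣ ϖ ^ (n - e) := pow_dvd_pow ϖ (by omega)
  constructor
  · intro h
    rw [pow_dvd_iff_le_emultiplicity, emultiplicity_mul hϖ.prime] at h
    simp only [pow_dvd_iff_le_emultiplicity]
    rcases lt_trichotomy (emultiplicity ϖ x) (emultiplicity ϖ 2) with hlt | heq | hgt
    · rw [add_comm x, emultiplicity_add_of_gt hlt] at h
      rw [he] at hlt
      lift emultiplicity ϖ x to ℕ using hlt.ne_top with m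
      norm_cast at h hlt
      omega
    · rw [heq, he] at h
      right
      generalize emultiplicity ϖ (x + 2) = m at h
      induction m using ENat.recTopCoe with
      | top => exact le_top
      | coe m =>
        norm_cast at h ⊢
        omega
    · rw [emultiplicity_add_of_gt hgt, he] at h
      left
      generalize emultiplicity ϖ x = m at h
      induction m using ENat.recTopCoe with
      | top => exact le_top
      | coe m =>
        norm_cast at h ⊢
        omega
  · rintro (h | h)
    · rw [show n = n - e + e by omega, pow_add]
      exact mul_dvd_mul h (dvd_add (hle.trans h) h2)
    · rw [show n = e + (n - e) by omega, pow_add]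
      refine mul_dvd_mul ?_ (by simpa using h)
      rw [← add_sub_cancel_right x 2]
      exact dvd_sub (hle.trans h) h2

omit [IsDomain R] [IsDiscreteValuationRing R] in
lemma index_squares_sup_principalUnits [IsLocalRing R] (n : ℕ) :
    ((powMonoidHom 2 : Rˣ →* Rˣ).range ⊔
      (Units.map (Ideal.Quotient.mk (maximalIdeal R ^ (n + 1))).toMonoidHom).ker).index =
      Nat.card (GroupSquareClasses (R ⧸ maximalIdeal R ^ (n + 1))ˣ) := by
  refine index_range_pow_two_sup_ker fun u => ?_
  obtain ⟨r, hr⟩ := Ideal.Quotient.mk_surjective (u : R ⧸ maximalIdeal R ^ (n + 1))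
  have hr' : IsUnit r := by
    have h := u.isUnit.map (quotResidue R n)
    rwa [← hr, quotResidue_mk, isUnit_iff_ne_zero, residue_ne_zero_iff_isUnit] at h
  exact ⟨hr'.unit, Units.ext hr⟩

variable [Finite (ResidueField R)]

lemma card_map_maximalIdeal_pow {i n : ℕ} (hi : i ≤ n) :
    Nat.card ((maximalIdeal R ^ i).map (Ideal.Quotient.mk (maximalIdeal R ^ n))) =
      Nat.card (ResidueField R) ^ (n - i) := by
  have h1 := Submodule.card_eq_card_quotient_mul_card
    ((maximalIdeal R ^ i).map (Ideal.Quotient.mk (maximalIdeal R ^ n)))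
  have h2 : Nat.card ((R ⧸ maximalIdeal R ^ n) ⧸
      (maximalIdeal R ^ i).map (Ideal.Quotient.mk (maximalIdeal R ^ n))) =
      Nat.card (R ⧸ maximalIdeal R ^ i) :=
    Nat.card_congr (DoubleQuot.quotQuotEquivQuotOfLE (Ideal.pow_le_pow_right hi)).toEquiv
  rw [h2, card_quotient_maximalIdeal_pow, card_quotient_maximalIdeal_pow] at h1
  refine Nat.eq_of_mul_eq_mul_right (pow_pos (Nat.card_pos (α := ResidueField R)) i) ?_
  rw [← pow_add, Nat.sub_add_cancel hi, h1, mul_comm]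

lemma card_squareClasses_of_le {ϖ : R} (hϖ : Irreducible ϖ) {n : ℕ}
    (hn : (n : ℕ∞) ≤ 2 * emultiplicity ϖ (2 : R)) :
    Nat.card (GroupSquareClasses (R ⧸ maximalIdeal R ^ n)ˣ) =
      Nat.card (ResidueField R) ^ (n / 2) := by
  have hi : (n + 1) / 2 ≤ n := by omega
  rw [card_groupSquareClasses, card_units_sq_eq_one, show n / 2 = n - (n + 1) / 2 by omega,
    ← card_map_maximalIdeal_pow hi]
  refine Nat.card_congr (Equiv.subtypeEquivRight fun x => ?_)
  obtain ⟨r, rfl⟩ := Ideal.Quotient.mk_surjective x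
  rw [mk_mem_map_maximalIdeal_pow hϖ hi, ← pow_dvd_mul_add_two_iff_of_le hϖ hn,
    ← mem_maximalIdeal_pow_iff hϖ, ← Ideal.Quotient.eq_zero_iff_mem, map_mul, map_add]
  rfl

lemma card_squareClasses_of_lt {ϖ : R} (hϖ : Irreducible ϖ) {n e : ℕ}
    (he : emultiplicity ϖ (2 : R) = e) (hn : 2 * e + 1 ≤ n) :
    Nat.card (GroupSquareClasses (R ⧸ maximalIdeal R ^ n)ˣ) =
      2 * Nat.card (ResidueField R) ^ e := by
  have hi : n - e ≤ n := by omega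
  let S := (maximalIdeal R ^ (n - e)).map (Ideal.Quotient.mk (maximalIdeal R ^ n))
  have hS : (S : Set (R ⧸ maximalIdeal R ^ n)).ncard = Nat.card (ResidueField R) ^ e := by
    have h := card_map_maximalIdeal_pow (R := R) hi
    rwa [show n - (n - e) = e by omega] at h
  have hunion : {x : R ⧸ maximalIdeal R ^ n | x * (x + 2) = 0} =
      (S : Set (R ⧸ maximalIdeal R ^ n)) ∪ (Equiv.addRight 2) ⁻¹' S := by
    ext x
    obtain ⟨r, rfl⟩ := Ideal.Quotient.mk_surjective x
    have h2 : Ideal.Quotient.mk (maximalIdeal R ^ n) r + 2 = Ideal.Quotient.mk _ (r + 2) := rfl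
    rw [Set.mem_union, Set.mem_preimage, SetLike.mem_coe, SetLike.mem_coe, Equiv.coe_addRight]
    dsimp only
    rw [h2,
      mk_mem_map_maximalIdeal_pow hϖ hi, mk_mem_map_maximalIdeal_pow hϖ hi,
      ← pow_dvd_mul_add_two_iff_of_lt hϖ he hn, ← mem_maximalIdeal_pow_iff hϖ,
      ← Ideal.Quotient.eq_zero_iff_mem, map_mul, ← h2]
    rfl
  have hdisj : Disjoint (S : Set (R ⧸ maximalIdeal R ^ n)) ((Equiv.addRight 2) ⁻¹' S) := by
    rw [Set.disjoint_left]
    intro x hx hx2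
    have h : (2 : R ⧸ maximalIdeal R ^ n) ∈ S := by
      rw [← add_sub_cancel_left x 2]
      exact S.sub_mem hx2 hx
    rw [← map_ofNat (Ideal.Quotient.mk (maximalIdeal R ^ n)) 2, mk_mem_map_maximalIdeal_pow hϖ hi,
      pow_dvd_iff_le_emultiplicity, he] at h
    norm_cast at h
    omega
  rw [card_groupSquareClasses, card_units_sq_eq_one, ← Set.coe_ofPred, Nat.card_coe_set_eq, hunion,
    Set.ncard_union_eq hdisj (Set.toFinite _) (Set.toFinite _), ← Equiv.image_symm_eq_preimage,
    Set.ncard_image_of_injective _ (Equiv.injective _), hS, two_mul]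

end DVR

section LocalField

variable (F : Type*) [Field F] [ValuativeRel F] [TopologicalSpace F] [IsNonarchimedeanLocalField F]

lemma card_squareClasses (k : ℕ) : Nat.card (SquareClasses F (k + 1)) =
    Nat.card (GroupSquareClasses (𝒪[F] ⧸ 𝓂[F] ^ (k + 1))ˣ) := by
  exact index_squares_sup_principalUnits k

end LocalField

lemma ceil_half (ℓ : ℕ) : ⌈(ℓ : ℚ) / 2⌉₊ = (ℓ + 1) / 2 := by
  apply le_antisymm
  · rw [Nat.ceil_le, div_le_iff₀ two_pos]
    exact_mod_cast (by omega : ℓ ≤ (ℓ + 1) / 2 * 2)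
  · have h := Nat.le_ceil ((ℓ : ℚ) / 2)
    rw [div_le_iff₀ two_pos] at h
    have : ℓ ≤ ⌈(ℓ : ℚ) / 2⌉₊ * 2 := by exact_mod_cast h
    omega

lemma floor_quarter (ℓ : ℕ) : ⌊((ℓ : ℚ) + 1) / 4⌋₊ = (ℓ + 1) / 4 := by
  have h := Nat.floor_div_natCast ((ℓ : ℚ) + 1) 4
  rw [show ((ℓ : ℚ) + 1) = ((ℓ + 1 : ℕ) : ℚ) by push_cast; rfl, Nat.floor_natCast] at h
  exact_mod_cast h

section LowerUnipotent

variable {R : Type*} [CommRing R]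

/-- The lower unipotent matrix `[1 0; c 1]`. -/
def lowerUnipotent (c : R) : SL(2, R) :=
  ⟨!![1, 0; c, 1], by simp [Matrix.det_fin_two]⟩

lemma coe_lowerUnipotent (c : R) :
    (lowerUnipotent c : Matrix (Fin 2) (Fin 2) R) = !![1, 0; c, 1] := rfl

lemma eq_upperUnipotent_mul_lowerUnipotent {g : SL(2, R)} (hg : g 1 1 = 1) :
    g = upperUnipotent (g 0 1) * lowerUnipotent (g 1 0) := by
  have hdet := g.det_coe
  rw [Matrix.det_fin_two, hg] at hdet
  ext i j
  fin_cases i <;> fin_cases j <;>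
    simp [coe_upperUnipotent, coe_lowerUnipotent, Matrix.mul_apply, hg]
  linear_combination hdet

lemma upperUnipotent_inv (x : R) : (upperUnipotent x)⁻¹ = upperUnipotent (-x) := by
  rw [inv_eq_iff_mul_eq_one, ← upperUnipotent_add, add_neg_cancel, upperUnipotent_zero]

lemma mul_upperUnipotent_mul_inv (g : SL(2, R)) (x : R) :
    ((g * upperUnipotent x * g⁻¹ : SL(2, R)) : Matrix (Fin 2) (Fin 2) R) =
      !![1 - x * g 0 0 * g 1 0, x * g 0 0 ^ 2; -(x * g 1 0 ^ 2), 1 + x * g 0 0 * g 1 0] := by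
  have hdet := g.det_coe
  rw [Matrix.det_fin_two] at hdet
  ext i j
  fin_cases i <;> fin_cases j <;>
    simp [coe_upperUnipotent, Matrix.SpecialLinearGroup.coe_inv, Matrix.adjugate_fin_two,
      Matrix.mul_apply, Fin.sum_univ_two]
  · linear_combination hdet
  · ring
  · ring
  · linear_combination hdet

lemma upperUnipotent_mul_lowerUnipotent_mul_inv (x c : R) :
    ((upperUnipotent x * lowerUnipotent c * (upperUnipotent x)⁻¹ : SL(2, R)) :
      Matrix (Fin 2) (Fin 2) R) = !![1 + x * c, -(x ^ 2 * c); c, 1 - x * c] := by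
  rw [upperUnipotent_inv]
  ext i j
  fin_cases i <;> fin_cases j <;>
    simp [coe_upperUnipotent, coe_lowerUnipotent, Matrix.mul_apply]
  · ring
  · ring

lemma coe_mul_apply (g h : SL(2, R)) (i j : Fin 2) :
    (g * h) i j = g i 0 * h 0 j + g i 1 * h 1 j := by
  simp [Matrix.mul_apply]

end LowerUnipotent

section LocalField

open IsLocalRing

variable {F : Type*} [Field F] [ValuativeRel F] [TopologicalSpace F] [IsNonarchimedeanLocalField F]
  {ϖ : 𝒪[F]} (hϖ : Irreducible ϖ)

lemma isOpen_maximalIdeal_pow (n : ℕ) : IsOpen ((𝓂[F] ^ n : Ideal 𝒪[F]) : Set 𝒪[F]) := by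
  let := IsTopologicalAddGroup.rightUniformSpace F
  have := isUniformAddGroup_of_addCommGroup (G := F)
  have hclosed : IsClosed ((𝓂[F] ^ n : Ideal 𝒪[F]) : Set 𝒪[F]) :=
    IsNoetherianRing.isClosed_ideal (𝓂[F] ^ n)
  have : ((𝓂[F] ^ n : Ideal 𝒪[F]).toAddSubgroup).FiniteIndex :=
    ⟨(Nat.card_pos (α := 𝒪[F] ⧸ 𝓂[F] ^ n)).ne'⟩
  exact AddSubgroup.isOpen_of_isClosed_of_finiteIndex (𝓂[F] ^ n : Ideal 𝒪[F]).toAddSubgroup hclosed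

lemma conjHom_apply (ℓ : ℕ) (b : lowerMod F ℓ) :
    conjHom hϖ ℓ b 0 0 = b.1 0 0 ∧ ϖ ^ ℓ * conjHom hϖ ℓ b 0 1 = b.1 0 1 ∧
      conjHom hϖ ℓ b 1 0 = ϖ ^ ℓ * b.1 1 0 ∧ conjHom hϖ ℓ b 1 1 = b.1 1 1 := by
  have h := inclGL_conjHom hϖ ℓ b
  rw [mul_assoc, eq_inv_mul_iff_mul_eq] at h
  have h' (i j) := congrArg (fun g : GL (Fin 2) F => (g : Matrix (Fin 2) (Fin 2) F) i j) h
  have hne : (ϖ : F) ^ ℓ ≠ 0 := pow_ne_zero _ (coe_ne_zero hϖ)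
  have h00 := h' 0 0
  have h01 := h' 0 1
  have h10 := h' 1 0
  have h11 := h' 1 1
  simp only [Matrix.GeneralLinearGroup.coe_mul, Matrix.mul_apply, Fin.sum_univ_two,
    inclGL_apply] at h00 h01 h10 h11
  simp [diagG, Matrix.GeneralLinearGroup.mkOfDetNeZero] at h00 h01 h10 h11
  refine ⟨Subtype.ext ?_, Subtype.ext ?_, Subtype.ext ?_, Subtype.ext ?_⟩
  · exact mul_left_cancel₀ hne (h00.trans (mul_comm _ _))
  · simpa using h01
  · simpa [mul_comm] using h10
  · simpa using h11

/-- The homomorphism from `lowerMod F ℓ` to `SL(2, 𝓀)` through which its representation factors. -/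
noncomputable def mackeyRed (ℓ : ℕ) : lowerMod F ℓ →* SL(2, 𝓀[F]) :=
  (Matrix.SpecialLinearGroup.map (residue 𝒪[F])).comp (conjHom hϖ ℓ)

lemma coe_mackeyRed {n : ℕ} (b : lowerMod F (n + 1)) {c : 𝒪[F]} (hc : b.1 0 1 = ϖ ^ (n + 1) * c) :
    (mackeyRed hϖ (n + 1) b : Matrix (Fin 2) (Fin 2) 𝓀[F]) =
      !![residue 𝒪[F] (b.1 0 0), residue 𝒪[F] c; 0, residue 𝒪[F] (b.1 1 1)] := by
  obtain ⟨h00, h01, h10, h11⟩ := conjHom_apply hϖ (n + 1) b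
  rw [hc] at h01
  have h01' := mul_left_cancel₀ (pow_ne_zero _ hϖ.ne_zero) h01
  ext i j
  fin_cases i <;> fin_cases j <;> simp [mackeyRed, h00, h01', h10, h11, residue_uniformizer hϖ]

lemma exists_mackeyRed_eq_upperUnipotent {n : ℕ} {g : SL(2, 𝒪[F])} {c : 𝒪[F]}
    (h01 : g 0 1 = ϖ ^ (n + 1) * c) (h00 : residue 𝒪[F] (g 0 0) = 1) :
    ∃ h : g ∈ lowerMod F (n + 1),
      mackeyRed hϖ (n + 1) ⟨g, h⟩ = upperUnipotent (residue 𝒪[F] c) := by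
  have h : g ∈ lowerMod F (n + 1) := by
    change g 0 1 ∈ 𝓂[F] ^ (n + 1)
    rw [h01, mem_maximalIdeal_pow_iff hϖ]
    exact dvd_mul_right _ _
  refine ⟨h, Subtype.ext ?_⟩
  have h11 : residue 𝒪[F] (g 1 1) = 1 := by
    have hdet := g.det_coe
    rw [Matrix.det_fin_two, h01, pow_succ] at hdet
    have := congrArg (residue 𝒪[F]) hdet
    simpa [h00, residue_uniformizer hϖ] using this
  rw [coe_mackeyRed hϖ ⟨g, h⟩ h01, h00, h11]
  rfl

lemma exists_mackeyRed_diagSL (n : ℕ) (u : (𝒪[F])ˣ) :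
    ∃ h : diagSL u ∈ lowerMod F (n + 1),
      mackeyRed hϖ (n + 1) ⟨diagSL u, h⟩ = diagSL (Units.map (residue 𝒪[F]).toMonoidHom u) := by
  have h : diagSL u ∈ lowerMod F (n + 1) := by
    change (diagSL u : Matrix (Fin 2) (Fin 2) 𝒪[F]) 0 1 ∈ 𝓂[F] ^ (n + 1)
    simp [coe_diagSL]
  refine ⟨h, Subtype.ext ?_⟩
  rw [coe_mackeyRed hϖ ⟨diagSL u, h⟩ (c := 0) (by simp [coe_diagSL])]
  simp [coe_diagSL]

lemma exists_eq_uniformizer_pow_mul {ϖ : 𝒪[F]} (hϖ : Irreducible ϖ) {ℓ : ℕ} (b : lowerMod F ℓ) : ∃ c, b.1 0 1 = ϖ ^ ℓ * c :=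
  ⟨_, (conjHom_apply hϖ ℓ b).2.1.symm⟩

lemma mem_lowerMod_of_map_eq_one (n : ℕ) {g : SL(2, 𝒪[F])}
    (hg : Matrix.SpecialLinearGroup.map (Ideal.Quotient.mk (𝓂[F] ^ (n + 2))) g = 1) :
    ∃ h : g ∈ lowerMod F (n + 1), mackeyRed hϖ (n + 1) ⟨g, h⟩ = 1 := by
  have h' (i j) := congrArg (fun g : SL(2, 𝒪[F] ⧸ 𝓂[F] ^ (n + 2)) => g i j) hg
  have h00 := h' 0 0
  have h01 := h' 0 1
  simp only [Matrix.SpecialLinearGroup.map_apply_coe, RingHom.mapMatrix_apply, Matrix.map_apply,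
    Matrix.SpecialLinearGroup.coe_one, Matrix.one_apply_eq, Matrix.one_apply_ne zero_ne_one] at h00 h01
  rw [Ideal.Quotient.eq_zero_iff_mem, mem_maximalIdeal_pow_iff hϖ] at h01
  obtain ⟨c, hc⟩ := h01
  rw [← map_one (Ideal.Quotient.mk (𝓂[F] ^ (n + 2))), Ideal.Quotient.eq,
    mem_maximalIdeal_pow_iff hϖ] at h00
  obtain ⟨h, hh⟩ := exists_mackeyRed_eq_upperUnipotent hϖ (g := g) (n := n) (c := ϖ * c)
    (by rw [hc, pow_succ, mul_assoc]) (by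
      rw [← map_one (residue 𝒪[F]), residue_eq_iff_dvd_sub hϖ]
      exact (dvd_pow_self ϖ (by omega)).trans h00)
  refine ⟨h, ?_⟩
  rw [hh, map_mul, residue_uniformizer hϖ, zero_mul, upperUnipotent_zero]

variable {W : Type*} [AddCommGroup W] [Module ℂ W] (σ : Representation ℂ SL(2, 𝓀[F]) W)

/-- Equivariant functions are automatically locally constant. -/
lemma mem_smoothIndV_iff (n : ℕ) (f : SL(2, 𝒪[F]) → W) :
    f ∈ smoothIndV (lowerMod F (n + 1))
        (MonoidHom.comp (inflation σ) (conjHom hϖ (n + 1))) ↔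
      ∀ (h : lowerMod F (n + 1)) g, f (h * g) = σ (mackeyRed hϖ (n + 1) h) (f g) := by
  refine ⟨fun hf => hf.1, fun hf => ⟨hf, ?_⟩⟩
  rw [IsLocallyConstant.iff_exists_open]
  intro x
  refine ⟨(fun y => y * x⁻¹) ⁻¹' {g | ∀ i j, g i j - (1 : SL(2, 𝒪[F])) i j ∈ 𝓂[F] ^ (n + 2)},
    ?_, ?_, fun y hy => ?_⟩
  · refine IsOpen.preimage (continuous_mul_const _) ?_
    simp only [Set.ofPred_forall]
    refine isOpen_iInter_of_finite fun i => isOpen_iInter_of_finite fun j => ?_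
    refine (isOpen_maximalIdeal_pow (n + 2)).preimage ?_
    exact (continuous_subtype_val.matrix_elem i j).sub continuous_const
  · intro i j
    simp only [mul_inv_cancel, sub_self]
    exact Ideal.zero_mem _
  · obtain ⟨h, hh⟩ := mem_lowerMod_of_map_eq_one hϖ n (g := y * x⁻¹) (by
      ext i j
      have := hy i j
      rw [← Ideal.Quotient.eq] at this
      simp only [Matrix.SpecialLinearGroup.map_apply_coe, RingHom.mapMatrix_apply, Matrix.map_apply]
      rw [this, Matrix.SpecialLinearGroup.coe_one, Matrix.SpecialLinearGroup.coe_one]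
      rw [Matrix.one_apply, Matrix.one_apply]
      split_ifs <;> simp)
    have := hf ⟨_, h⟩ x
    rwa [hh, map_one, Module.End.one_apply, inv_mul_cancel_right] at this

lemma mackey_apply (ℓ : ℕ) (g x : SL(2, 𝒪[F])) (f) :
    (mackey hϖ σ ℓ g f).1 x = f.1 (x * g) := rfl

/-- The subgroup of the elements of `lowerMod F ℓ` which reduce to an upper unipotent matrix. -/
def unipotentMod (ℓ : ℕ) : Subgroup SL(2, 𝒪[F]) where
  carrier := {g | ∃ h : g ∈ lowerMod F ℓ, ∃ c, mackeyRed hϖ ℓ ⟨g, h⟩ = upperUnipotent c}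
  one_mem' := ⟨one_mem _, 0, by rw [upperUnipotent_zero]; exact map_one _⟩
  mul_mem' := by
    rintro a b ⟨ha, c, hc⟩ ⟨hb, d, hd⟩
    exact ⟨mul_mem ha hb, c + d, by rw [upperUnipotent_add, ← hc, ← hd, ← map_mul]; rfl⟩
  inv_mem' := by
    rintro a ⟨ha, c, hc⟩
    exact ⟨inv_mem ha, -c, by rw [← upperUnipotent_inv, ← hc, ← map_inv]; rfl⟩

/-- The multiplicative function on `unipotentMod hϖ ℓ` defined by an additive character of `𝓀`. -/
noncomputable def unipotentChar (ℓ : ℕ) (ψ : AddChar 𝓀[F] ℂ) (u : unipotentMod hϖ ℓ) : ℂ :=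
  ψ (mackeyRed hϖ ℓ ⟨u.1, u.2.choose⟩ 0 1)

lemma unipotentChar_eq {ℓ : ℕ} (ψ : AddChar 𝓀[F] ℂ) (u : unipotentMod hϖ ℓ)
    {h : u.1 ∈ lowerMod F ℓ} {c : 𝓀[F]} (hc : mackeyRed hϖ ℓ ⟨u.1, h⟩ = upperUnipotent c) :
    unipotentChar hϖ ℓ ψ u = ψ c := by
  rw [unipotentChar, hc]
  rfl

instance finiteIndex_unipotentMod (n : ℕ) : (unipotentMod hϖ (n + 1)).FiniteIndex := by
  have : (Matrix.SpecialLinearGroup.map (n := Fin 2)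
    (Ideal.Quotient.mk (𝓂[F] ^ (n + 2)))).ker.FiniteIndex := Subgroup.finiteIndex_ker _
  refine Subgroup.finiteIndex_of_le (fun g hg => ?_ :
    (Matrix.SpecialLinearGroup.map (n := Fin 2) (Ideal.Quotient.mk (𝓂[F] ^ (n + 2)))).ker ≤ _)
  obtain ⟨h, hh⟩ := mem_lowerMod_of_map_eq_one hϖ n hg
  exact ⟨h, 0, by rw [hh, upperUnipotent_zero]⟩

end LocalField

lemma IsWhittaker.lam_diagSL_eq_zero {k W : Type*} [Field k] [CharP k 2] [AddCommGroup W]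
    [Module ℂ W] {σ : Representation ℂ SL(2, k) W} {ψ : AddChar k ℂ} {w₀ : W} {lam : W →ₗ[ℂ] ℂ}
    (hw : IsWhittaker σ ψ w₀ lam) {s : kˣ} (hs : s ≠ 1) : lam (σ (diagSL s) w₀) = 0 := by
  by_contra hne
  have h (x : k) : ψ ((s : k) ^ 2 * x) = ψ x := by
    refine mul_right_cancel₀ hne ?_
    rw [← hw.lam_eigen, ← Module.End.mul_apply, ← map_mul, ← diagSL_mul_upperUnipotent, map_mul,
      Module.End.mul_apply, hw.vec_eigen, map_smul, map_smul, smul_eq_mul]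
  have h1 := addChar_eq_one_of_mul_eq hw.ne_one h
  refine hs (Units.ext ?_)
  have : ((s : k) - 1) ^ 2 = 0 := by rw [sub_pow_char, h1]; simp
  exact sub_eq_zero.1 (pow_eq_zero_iff two_ne_zero |>.1 this)

section LocalField

open IsLocalRing

variable {F : Type*} [Field F] [ValuativeRel F] [TopologicalSpace F] [IsNonarchimedeanLocalField F]
  {ϖ : 𝒪[F]} (hϖ : Irreducible ϖ)
  {W : Type*} [AddCommGroup W] [Module ℂ W] (σ : Representation ℂ SL(2, 𝓀[F]) W)

/-- The space of the Mackey component. -/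
noncomputable abbrev mackeyV (ℓ : ℕ) : Submodule ℂ (SL(2, 𝒪[F]) → W) :=
  smoothIndV (lowerMod F ℓ) (MonoidHom.comp (inflation σ) (conjHom hϖ ℓ))

variable {σ}

lemma mackeyV_lower {ℓ : ℕ} (f : mackeyV hϖ σ ℓ) (h : lowerMod F ℓ) (g : SL(2, 𝒪[F])) :
    f.1 (h * g) = σ (mackeyRed hϖ ℓ h) (f.1 g) := f.2.1 h g

lemma mackeyV_diagSL {n : ℕ} (f : mackeyV hϖ σ (n + 1)) (u : (𝒪[F])ˣ) (g : SL(2, 𝒪[F])) :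
    f.1 (diagSL u * g) = σ (diagSL (Units.map (residue 𝒪[F]).toMonoidHom u)) (f.1 g) := by
  obtain ⟨h, hh⟩ := exists_mackeyRed_diagSL hϖ n u
  rw [← hh, ← mackeyV_lower hϖ f ⟨_, h⟩]

lemma mackeyV_unipotent {n : ℕ} (f : mackeyV hϖ σ (n + 1)) {h : SL(2, 𝒪[F])} {c : 𝒪[F]}
    (h01 : h 0 1 = ϖ ^ (n + 1) * c) (h00 : residue 𝒪[F] (h 0 0) = 1) (g : SL(2, 𝒪[F])) :
    f.1 (h * g) = σ (upperUnipotent (residue 𝒪[F] c)) (f.1 g) := by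
  obtain ⟨hm, hh⟩ := exists_mackeyRed_eq_upperUnipotent hϖ h01 h00
  rw [← hh, ← mackeyV_lower hϖ f ⟨_, hm⟩]

variable (σ) in
/-- The eigenvectors in the Mackey component for the character of `unipotentMod` given by `ψ`. -/
noncomputable def mackeyEigen (ℓ : ℕ) (ψ : AddChar 𝓀[F] ℂ) : Submodule ℂ (mackeyV hϖ σ ℓ) where
  carrier := {f | ∀ u : unipotentMod hϖ ℓ, mackey hϖ σ ℓ u f = unipotentChar hϖ ℓ ψ u • f}
  add_mem' ha hb u := by rw [map_add, ha u, hb u, smul_add]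
  zero_mem' u := by rw [map_zero, smul_zero]
  smul_mem' c f hf u := by rw [map_smul, hf u, smul_comm]

/-- The element of the Mackey component supported on `lowerMod F ℓ` with value `w` at `1`. -/
noncomputable def mackeyBase (n : ℕ) (w : W) : mackeyV hϖ σ (n + 1) :=
  open Classical in
  ⟨fun g => if h : g ∈ lowerMod F (n + 1) then σ (mackeyRed hϖ (n + 1) ⟨g, h⟩) w else 0, by
    rw [mem_smoothIndV_iff]
    intro h g
    by_cases hg : g ∈ lowerMod F (n + 1)
    · rw [dif_pos hg, dif_pos (mul_mem h.2 hg), ← Module.End.mul_apply, ← map_mul, ← map_mul]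
      rfl
    · rw [dif_neg hg, dif_neg (fun h' => hg ((Subgroup.mul_mem_cancel_left _ h.2).1 h')), map_zero]⟩

lemma mackeyBase_of_mem {n : ℕ} {w : W} {g : SL(2, 𝒪[F])} (h : g ∈ lowerMod F (n + 1)) :
    (mackeyBase hϖ (σ := σ) n w).1 g = σ (mackeyRed hϖ (n + 1) ⟨g, h⟩) w := dif_pos h

lemma mackeyBase_of_notMem {n : ℕ} {w : W} {g : SL(2, 𝒪[F])} (h : g ∉ lowerMod F (n + 1)) :
    (mackeyBase hϖ (σ := σ) n w).1 g = 0 := dif_neg h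

lemma eq_diagSL_mul_upperUnipotent {k : Type*} [Field k] {g : SL(2, k)} (hg : g 1 0 = 0) :
    ∃ (s : kˣ) (x : k), g = upperUnipotent x * diagSL s := by
  have hdet := g.det_coe
  rw [Matrix.det_fin_two, hg, mul_zero, sub_zero] at hdet
  refine ⟨⟨g 0 0, g 1 1, hdet, by rw [mul_comm, hdet]⟩, g 0 1 * g 0 0, ?_⟩
  ext i j
  fin_cases i <;> fin_cases j <;>
    simp [coe_upperUnipotent, coe_diagSL, Matrix.mul_apply, hg]
  rw [mul_assoc, hdet, mul_one]

lemma nonempty_end_mackey_equiv [CharP 𝓀[F] 2] {ψ : AddChar 𝓀[F] ℂ} {w₀ : W} {lam : W →ₗ[ℂ] ℂ}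
    (hw : IsWhittaker σ ψ w₀ lam) (n : ℕ) :
    Nonempty (Representation.IntertwiningMap (mackey hϖ σ (n + 1)) (mackey hϖ σ (n + 1)) ≃ₗ[ℂ]
      mackeyEigen hϖ σ (n + 1) ψ) := by
  refine nonempty_end_equiv_eigenvectors (mackey hϖ σ (n + 1)) (unipotentMod hϖ (n + 1))
    (unipotentChar hϖ (n + 1) ψ) (mackeyBase hϖ n w₀)
    (lam.comp ((LinearMap.proj 1).comp (mackeyV hϖ σ (n + 1)).subtype))
    (fun u => ?_) (fun u f => ?_) ?_ (fun g hg => ?_) (fun f hf => ?_) _ (fun f => Iff.rfl)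
  · obtain ⟨h, c, hc⟩ := u.2
    refine Subtype.ext (funext fun x => ?_)
    rw [mackey_apply, unipotentChar_eq hϖ ψ u hc]
    change _ = ψ c • (mackeyBase hϖ n w₀).1 x
    by_cases hx : x ∈ lowerMod F (n + 1)
    · rw [mackeyBase_of_mem hϖ hx, mackeyBase_of_mem hϖ (mul_mem hx h), ← map_smul, ← hw.vec_eigen,
        ← hc, ← Module.End.mul_apply, ← map_mul, ← map_mul]
      rfl
    · rw [mackeyBase_of_notMem hϖ hx, mackeyBase_of_notMem hϖ
        (fun h' => hx ((Subgroup.mul_mem_cancel_right _ h).1 h')), smul_zero]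
  · obtain ⟨h, c, hc⟩ := u.2
    change lam ((mackey hϖ σ (n + 1) u f).1 1) = _ * lam (f.1 1)
    rw [mackey_apply, one_mul, unipotentChar_eq hϖ ψ u hc, ← hw.lam_eigen, ← hc,
      ← mackeyV_lower hϖ f, mul_one]
  · change lam ((mackeyBase hϖ n w₀).1 1) = 1
    rw [mackeyBase_of_mem hϖ (one_mem _), show (⟨1, one_mem _⟩ : lowerMod F (n + 1)) = 1 from rfl,
      map_one, map_one, Module.End.one_apply, hw.lam_vec]
  · change lam ((mackey hϖ σ (n + 1) g (mackeyBase hϖ n w₀)).1 1) = 0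
    rw [mackey_apply, one_mul]
    by_cases hm : g ∈ lowerMod F (n + 1)
    · obtain ⟨c, hc⟩ := exists_eq_uniformizer_pow_mul hϖ ⟨g, hm⟩
      obtain ⟨s, x, hsx⟩ := eq_diagSL_mul_upperUnipotent (g := mackeyRed hϖ (n + 1) ⟨g, hm⟩)
        (by rw [coe_mackeyRed hϖ ⟨g, hm⟩ hc]; rfl)
      rw [mackeyBase_of_mem hϖ hm, hsx, map_mul, Module.End.mul_apply, hw.lam_eigen,
        hw.lam_diagSL_eq_zero, mul_zero]
      rintro rfl
      exact hg ⟨hm, x, by rw [hsx, diagSL_one, mul_one]⟩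
    · rw [mackeyBase_of_notMem hϖ hm, map_zero]
  · refine Subtype.ext (funext fun g => hw.eq_zero _ fun s => ?_)
    obtain ⟨r, hr⟩ := residue_surjective (s : 𝓀[F])
    have hr' : IsUnit r := by
      rw [← residue_ne_zero_iff_isUnit, hr]
      exact s.ne_zero
    have hs : Units.map (residue 𝒪[F]).toMonoidHom hr'.unit = s := Units.ext hr
    rw [← hs, ← mackeyV_diagSL]
    have h := hf (diagSL hr'.unit * g)
    change lam ((mackey hϖ σ (n + 1) _ f).1 1) = 0 at h
    rwa [mackey_apply, one_mul] at h

lemma mackeyEigen_apply {n : ℕ} {ψ : AddChar 𝓀[F] ℂ} (f : mackeyEigen hϖ σ (n + 1) ψ)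
    {u : SL(2, 𝒪[F])} {c : 𝒪[F]} (h01 : u 0 1 = ϖ ^ (n + 1) * c)
    (h00 : residue 𝒪[F] (u 0 0) = 1) (g : SL(2, 𝒪[F])) :
    f.1.1 (g * u) = ψ (residue 𝒪[F] c) • f.1.1 g := by
  obtain ⟨hm, hh⟩ := exists_mackeyRed_eq_upperUnipotent hϖ h01 h00
  have h := f.2 ⟨u, hm, _, hh⟩
  rw [unipotentChar_eq hϖ ψ ⟨u, hm, _, hh⟩ hh] at h
  exact congrFun (congrArg Subtype.val h) g

end LocalField

section LocalField

open IsLocalRing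

variable {F : Type*} [Field F] [ValuativeRel F] [TopologicalSpace F] [IsNonarchimedeanLocalField F]
  {ϖ : 𝒪[F]} (hϖ : Irreducible ϖ)
  {W : Type*} [AddCommGroup W] [Module ℂ W] {σ : Representation ℂ SL(2, 𝓀[F]) W}
  {ψ : AddChar 𝓀[F] ℂ} {w₀ : W} {lam : W →ₗ[ℂ] ℂ}

lemma eq_zero_of_forall_addChar_smul {k : Type*} [AddCommGroup k] {χ : AddChar k ℂ} (hχ : χ ≠ 1)
    {w : W} (h : ∀ x, χ x • w = w) : w = 0 := by
  obtain ⟨x, hx⟩ := AddChar.ne_one_iff.1 hχ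
  have h1 : (χ x - 1) • w = 0 := by rw [sub_smul, h, one_smul, sub_self]
  exact (smul_eq_zero.1 h1).resolve_left (sub_ne_zero.2 hx)

lemma mackeyEigen_unipotent_apply {n : ℕ} (f : mackeyEigen hϖ σ (n + 1) ψ) (g : SL(2, 𝒪[F]))
    (b : 𝒪[F]) : σ (upperUnipotent (residue 𝒪[F] (b * g 0 0 ^ 2))) (f.1.1 g) =
      ψ (residue 𝒪[F] b) • f.1.1 g := by
  have h := mul_upperUnipotent_mul_inv g (ϖ ^ (n + 1) * b)
  have h01 : (g * upperUnipotent (ϖ ^ (n + 1) * b) * g⁻¹) 0 1 =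
      ϖ ^ (n + 1) * (b * g 0 0 ^ 2) := by
    rw [h]
    simp [mul_assoc]
  have h00 : residue 𝒪[F] ((g * upperUnipotent (ϖ ^ (n + 1) * b) * g⁻¹) 0 0) = 1 := by
    rw [h]
    simp [residue_uniformizer hϖ]
  rw [← mackeyV_unipotent hϖ f.1 h01 h00, inv_mul_cancel_right,
    mackeyEigen_apply hϖ f (c := b) (by simp [coe_upperUnipotent]) (by simp [coe_upperUnipotent])]

lemma mackeyEigen_mul_lowerUnipotent {n : ℕ} (f : mackeyEigen hϖ σ (n + 1) ψ) (g : SL(2, 𝒪[F]))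
    (c : 𝒪[F]) : f.1.1 (g * lowerUnipotent c) = f.1.1 g := by
  rw [mackeyEigen_apply hϖ f (c := 0) (by simp [coe_lowerUnipotent])
    (by simp [coe_lowerUnipotent]), map_zero, ψ.map_zero_eq_one, one_smul]

lemma mackeyEigen_eq_zero_of_residue_eq_zero (hψ : ψ ≠ 1) {n : ℕ}
    (f : mackeyEigen hϖ σ (n + 1) ψ) {g : SL(2, 𝒪[F])} (hg : residue 𝒪[F] (g 0 0) = 0) :
    f.1.1 g = 0 := by
  refine eq_zero_of_forall_addChar_smul hψ fun x => ?_
  obtain ⟨b, rfl⟩ := residue_surjective x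
  rw [← mackeyEigen_unipotent_apply hϖ f, map_mul, map_pow, hg]
  simp [upperUnipotent_zero]

lemma mackeyEigen_eq_zero_of_isUnit (hψ : ψ ≠ 1) {n : ℕ} (f : mackeyEigen hϖ σ (n + 1) ψ)
    {g : SL(2, 𝒪[F])} (hg : IsUnit (g 0 1)) : f.1.1 g = 0 := by
  obtain ⟨v, hv⟩ := hg
  rw [← mackeyEigen_mul_lowerUnipotent hϖ f g (-(g 0 0 * ((v⁻¹ : (𝒪[F])ˣ) : 𝒪[F])))]
  refine mackeyEigen_eq_zero_of_residue_eq_zero hϖ hψ f ?_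
  have h0 : (g * lowerUnipotent (-(g 0 0 * ((v⁻¹ : (𝒪[F])ˣ) : 𝒪[F])))) 0 0 = 0 := by
    rw [coe_mul_apply, ← hv]
    simp [coe_lowerUnipotent]
    linear_combination -(g 0 0) * v.mul_inv
  rw [h0, map_zero]

lemma mackeyEigen_upperUnipotent_eq_zero (hψ : ψ ≠ 1) {n i : ℕ} (f : mackeyEigen hϖ σ (n + 1) ψ)
    (hi : 1 ≤ i) (hi' : 2 * i ≤ n + 1) (v : (𝒪[F])ˣ) :
    f.1.1 (upperUnipotent (v * ϖ ^ i)) = 0 := by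
  refine eq_zero_of_forall_addChar_smul hψ fun x => ?_
  obtain ⟨b, rfl⟩ := residue_surjective x
  let c : 𝒪[F] := -(ϖ ^ (n + 1 - 2 * i) * ((v⁻¹ : (𝒪[F])ˣ) : 𝒪[F]) ^ 2 * b)
  have h := upperUnipotent_mul_lowerUnipotent_mul_inv ((v : 𝒪[F]) * ϖ ^ i) c
  have hc : -(((v : 𝒪[F]) * ϖ ^ i) ^ 2 * c) = ϖ ^ (n + 1) * b := by
    have hv : (v : 𝒪[F]) * ((v⁻¹ : (𝒪[F])ˣ) : 𝒪[F]) = 1 := v.mul_inv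
    have hp : (ϖ ^ i) ^ 2 * ϖ ^ (n + 1 - 2 * i) = ϖ ^ (n + 1) := by
      rw [← pow_mul, ← pow_add]
      congr 1
      omega
    calc _ = ((v : 𝒪[F]) * ((v⁻¹ : (𝒪[F])ˣ) : 𝒪[F])) ^ 2 *
          ((ϖ ^ i) ^ 2 * ϖ ^ (n + 1 - 2 * i)) * b := by ring
      _ = _ := by rw [hv, hp, one_pow, one_mul]
  set g := upperUnipotent ((v : 𝒪[F]) * ϖ ^ i) with hg
  have h01 : (g * lowerUnipotent c * g⁻¹) 0 1 = ϖ ^ (n + 1) * b := by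
    rw [h, ← hc]
    rfl
  have h00 : residue 𝒪[F] ((g * lowerUnipotent c * g⁻¹) 0 0) = 1 := by
    rw [h]
    simp [residue_uniformizer hϖ, zero_pow (by omega : i ≠ 0)]
  have h1 := mackeyV_unipotent hϖ f.1 h01 h00 g
  rw [inv_mul_cancel_right, mackeyEigen_mul_lowerUnipotent] at h1
  have h2 := mackeyEigen_unipotent_apply hϖ f g b
  have hg00 : g 0 0 = 1 := rfl
  rw [hg00, one_pow, mul_one] at h2
  rw [← h2, ← h1]

lemma mackeyEigen_eq_zero (hw : IsWhittaker σ ψ w₀ lam) {n : ℕ} (f : mackeyEigen hϖ σ (n + 1) ψ)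
    (hf : ∀ y, lam (f.1.1 (upperUnipotent (ϖ ^ (n + 1 - n / 2) * y))) = 0) : f = 0 := by
  have hupper (x : 𝒪[F]) (hx : residue 𝒪[F] x = 0) : f.1.1 (upperUnipotent x) = 0 := by
    by_cases hdvd : ϖ ^ (n + 1 - n / 2) ∣ x
    · obtain ⟨y, rfl⟩ := hdvd
      rw [hw.eq_smul (f.1.1 (upperUnipotent (ϖ ^ (n + 1 - n / 2) * y))) fun z => ?_, hf, zero_smul]
      obtain ⟨b, rfl⟩ := residue_surjective z
      have h := mackeyEigen_unipotent_apply hϖ f (upperUnipotent (ϖ ^ (n + 1 - n / 2) * y)) b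
      simpa [coe_upperUnipotent] using h
    · have hx0 : x ≠ 0 := fun h => hdvd (h ▸ dvd_zero _)
      obtain ⟨i, v, rfl⟩ := IsDiscreteValuationRing.eq_unit_mul_pow_irreducible hx0 hϖ
      have hi : i < n + 1 - n / 2 := by
        by_contra hi
        exact hdvd (Dvd.dvd.mul_left (pow_dvd_pow ϖ (by omega)) _)
      have hi0 : i ≠ 0 := by
        rintro rfl
        rw [pow_zero, mul_one] at hx
        exact (residue_ne_zero_iff_isUnit _).2 v.isUnit hx
      exact mackeyEigen_upperUnipotent_eq_zero hϖ hw.ne_one f (by omega) (by omega) v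
  refine Subtype.ext (Subtype.ext (funext fun g => ?_))
  by_cases hg : residue 𝒪[F] (g 0 1) = 0
  · have hdet := g.det_coe
    rw [Matrix.det_fin_two] at hdet
    have h11 : IsUnit (g 1 1) := by
      rw [← residue_ne_zero_iff_isUnit]
      intro h
      have := congrArg (residue 𝒪[F]) hdet
      simp [hg, h] at this
    obtain ⟨v, hv⟩ := h11
    have hprod : (diagSL v * g) 1 1 = 1 := by
      rw [coe_mul_apply, ← hv]
      simp [coe_diagSL]
    have h1 := mackeyV_diagSL hϖ f.1 v g
    rw [eq_upperUnipotent_mul_lowerUnipotent hprod, mackeyEigen_mul_lowerUnipotent, hupper] at h1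
    · have h2 := congrArg (σ (diagSL (Units.map (residue 𝒪[F]).toMonoidHom v))⁻¹) h1
      rw [map_zero, ← Module.End.mul_apply, ← map_mul, inv_mul_cancel, map_one] at h2
      exact h2.symm
    · rw [coe_mul_apply]
      simp [coe_diagSL, hg]
  · exact mackeyEigen_eq_zero_of_isUnit hϖ hw.ne_one f ((residue_ne_zero_iff_isUnit _).1 hg)

variable (σ w₀) in
/-- The vector `σ(diag(d⁻¹, d)) w₀`, and `0` for `d = 0`. -/
noncomputable def torusVec (d : 𝓀[F]) : W :=
  open Classical in if h : d ≠ 0 then σ (diagSL (Units.mk0 d h)⁻¹) w₀ else 0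

lemma torusVec_of_ne_zero {d : 𝓀[F]} (h : d ≠ 0) :
    torusVec σ w₀ d = σ (diagSL (Units.mk0 d h)⁻¹) w₀ := dif_pos h

lemma apply_torusVec (hw : IsWhittaker σ ψ w₀ lam) {a b d δ : 𝓀[F]} (had : a * d = 1) (hδ : δ ≠ 0)
    {g : SL(2, 𝓀[F])} (hg : (g : Matrix (Fin 2) (Fin 2) 𝓀[F]) = !![a, b; 0, d]) :
    σ g (torusVec σ w₀ δ) = ψ (b * d * δ ^ 2) • torusVec σ w₀ (d * δ) := by
  have hd : d ≠ 0 := right_ne_zero_of_mul_eq_one had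
  rw [torusVec_of_ne_zero hδ, torusVec_of_ne_zero (mul_ne_zero hd hδ), ← map_smul, ← hw.vec_eigen,
    ← Module.End.mul_apply, ← Module.End.mul_apply, ← map_mul, ← map_mul]
  congr 2
  have ha : a = d⁻¹ := eq_inv_of_mul_eq_one_left had
  ext i j
  fin_cases i <;> fin_cases j <;>
    simp [hg, coe_diagSL, coe_upperUnipotent, Matrix.mul_apply, ha, mul_comm]
  field_simp

variable (σ w₀) in
/-- The function on `SL(2, 𝒪)` built from a function `φ` on `𝒪`. -/
noncomputable def extendFun (ϖ : 𝒪[F]) (j : ℕ) (φ : 𝒪[F] → ℂ) (g : SL(2, 𝒪[F])) : W :=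
  open Classical in
  if h : ϖ ^ j ∣ g 0 1 then φ (h.choose * g 1 1) • torusVec σ w₀ (residue 𝒪[F] (g 1 1)) else 0

include hϖ in
lemma extendFun_of_eq {j : ℕ} {φ : 𝒪[F] → ℂ} {g : SL(2, 𝒪[F])} {y : 𝒪[F]}
    (h : g 0 1 = ϖ ^ j * y) : extendFun σ w₀ ϖ j φ g =
      φ (y * g 1 1) • torusVec σ w₀ (residue 𝒪[F] (g 1 1)) := by
  have hd : ϖ ^ j ∣ g 0 1 := ⟨y, h⟩
  have hy : hd.choose = y :=
    mul_left_cancel₀ (pow_ne_zero j hϖ.ne_zero) (hd.choose_spec.symm.trans h)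
  rw [extendFun, dif_pos hd, hy]

lemma extendFun_of_not_dvd {j : ℕ} {φ : 𝒪[F] → ℂ} {g : SL(2, 𝒪[F])} (h : ¬ ϖ ^ j ∣ g 0 1) :
    extendFun σ w₀ ϖ j φ g = 0 := dif_neg h

lemma residue_det (g : SL(2, 𝒪[F])) : residue 𝒪[F] (g 0 0) * residue 𝒪[F] (g 1 1) -
    residue 𝒪[F] (g 0 1) * residue 𝒪[F] (g 1 0) = 1 := by
  have hdet := g.det_coe
  rw [Matrix.det_fin_two] at hdet
  rw [← map_mul, ← map_mul, ← map_sub, hdet, map_one]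

lemma extendFun_lower (hw : IsWhittaker σ ψ w₀ lam) {n : ℕ} {φ : 𝒪[F] → ℂ}
    (hφ : φ ∈ equivariantFun ϖ (n / 2) ψ) (h : lowerMod F (n + 1)) (g : SL(2, 𝒪[F])) :
    extendFun σ w₀ ϖ (n + 1 - n / 2) φ (h * g) =
      σ (mackeyRed hϖ (n + 1) h) (extendFun σ w₀ ϖ (n + 1 - n / 2) φ g) := by
  obtain ⟨b, hb⟩ := exists_eq_uniformizer_pow_mul hϖ h
  obtain ⟨t, ht⟩ : ∃ t, n + 1 - n / 2 = n / 2 + (1 + t) := ⟨n - 2 * (n / 2), by omega⟩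
  have hj : ϖ ^ (n + 1 - n / 2) = ϖ ^ (n / 2) * (ϖ * ϖ ^ t) := by rw [ht, pow_add, pow_add, pow_one]
  have hl : ϖ ^ (n + 1) = ϖ ^ (n / 2) * ϖ ^ (n + 1 - n / 2) := by
    rw [← pow_add]
    congr 1
    omega
  have hres := residue_det h.1
  rw [hb, map_mul, map_pow, residue_uniformizer hϖ, zero_pow n.succ_ne_zero, zero_mul, zero_mul,
    sub_zero] at hres
  have hdet := h.1.det_coe
  rw [Matrix.det_fin_two, hb] at hdet
  have hu : IsUnit (h.1 0 0) := by
    rw [← residue_ne_zero_iff_isUnit]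
    exact left_ne_zero_of_mul_eq_one hres
  by_cases hg : ϖ ^ (n + 1 - n / 2) ∣ g 0 1
  · obtain ⟨y, hy⟩ := hg
    have hres' := residue_det g
    rw [hy, hj, map_mul, map_mul, map_mul, residue_uniformizer hϖ, zero_mul, mul_zero, zero_mul,
      zero_mul, sub_zero] at hres'
    have hδ : residue 𝒪[F] (g 1 1) ≠ 0 := right_ne_zero_of_mul_eq_one hres'
    have h01 : (h.1 * g) 0 1 =
        ϖ ^ (n + 1 - n / 2) * (h.1 0 0 * y + ϖ ^ (n / 2) * b * g 1 1) := by
      rw [coe_mul_apply, hy, hb, hl]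
      ring
    have h11 : (h.1 * g) 1 1 = h.1 1 0 * (ϖ ^ (n / 2) * (ϖ * ϖ ^ t) * y) + h.1 1 1 * g 1 1 := by
      rw [coe_mul_apply, hy, hj]
    have hprod : (h.1 0 0 * y + ϖ ^ (n / 2) * b * g 1 1) * (h.1 * g) 1 1 = y * g 1 1 +
        ϖ ^ (n / 2) * (b * h.1 1 1 * g 1 1 ^ 2 + ϖ * (ϖ ^ t * h.1 0 0 * h.1 1 0 * y ^ 2 +
          ϖ ^ (n / 2) * ϖ ^ t * b * h.1 1 0 * y * g 1 1 * 2)) := by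
      rw [h11]
      rw [hl, hj] at hdet
      linear_combination y * g 1 1 * hdet
    have h11' : residue 𝒪[F] ((h.1 * g) 1 1) = residue 𝒪[F] (h.1 1 1) * residue 𝒪[F] (g 1 1) := by
      rw [h11]
      simp [residue_uniformizer hϖ]
    rw [extendFun_of_eq hϖ h01, extendFun_of_eq hϖ hy, map_smul,
      apply_torusVec hw hres hδ (coe_mackeyRed hϖ h hb), hprod, hφ.1, h11', smul_smul, mul_comm]
    simp [residue_uniformizer hϖ]
  · have hg' : ¬ ϖ ^ (n + 1 - n / 2) ∣ (h.1 * g) 0 1 := by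
      rw [coe_mul_apply, hb, hl, mul_assoc, mul_assoc, mul_left_comm,
        dvd_add_left (dvd_mul_right _ _), hu.dvd_mul_left]
      exact hg
    rw [extendFun_of_not_dvd hg, extendFun_of_not_dvd hg', map_zero]

include hϖ in
lemma extendFun_right {n : ℕ} {φ : 𝒪[F] → ℂ} (hφ : φ ∈ equivariantFun ϖ (n / 2) ψ)
    {u : SL(2, 𝒪[F])} {b : 𝒪[F]} (hb : u 0 1 = ϖ ^ (n + 1) * b)
    (h00 : residue 𝒪[F] (u 0 0) = 1) (g : SL(2, 𝒪[F])) :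
    extendFun σ w₀ ϖ (n + 1 - n / 2) φ (g * u) =
      ψ (residue 𝒪[F] b) • extendFun σ w₀ ϖ (n + 1 - n / 2) φ g := by
  obtain ⟨t, ht⟩ : ∃ t, n + 1 - n / 2 = n / 2 + (1 + t) := ⟨n - 2 * (n / 2), by omega⟩
  have hj : ϖ ^ (n + 1 - n / 2) = ϖ ^ (n / 2) * (ϖ * ϖ ^ t) := by rw [ht, pow_add, pow_add, pow_one]
  have hl : ϖ ^ (n + 1) = ϖ ^ (n / 2) * ϖ ^ (n + 1 - n / 2) := by
    rw [← pow_add]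
    congr 1
    omega
  have hd := residue_det u
  rw [hb, map_mul, map_pow, residue_uniformizer hϖ, zero_pow n.succ_ne_zero, zero_mul, zero_mul,
    sub_zero, h00, one_mul] at hd
  have hu : IsUnit (u 1 1) := by
    rw [← residue_ne_zero_iff_isUnit, hd]
    exact one_ne_zero
  by_cases hg : ϖ ^ (n + 1 - n / 2) ∣ g 0 1
  · obtain ⟨y, hy⟩ := hg
    have hres' := residue_det g
    rw [hy, hj, map_mul, map_mul, map_mul, residue_uniformizer hϖ, zero_mul, mul_zero, zero_mul,
      zero_mul, sub_zero] at hres'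
    have h01 : (g * u) 0 1 = ϖ ^ (n + 1 - n / 2) * (ϖ ^ (n / 2) * b * g 0 0 + y * u 1 1) := by
      rw [coe_mul_apply, hy, hb, hl]
      ring
    have h11 : (g * u) 1 1 = g 1 0 * (ϖ ^ (n / 2) * (ϖ ^ (n / 2) * (ϖ * ϖ ^ t)) * b) +
        g 1 1 * u 1 1 := by
      rw [coe_mul_apply, hb, hl, hj]
    have hprod : (ϖ ^ (n / 2) * b * g 0 0 + y * u 1 1) * (g * u) 1 1 =
        u 1 1 ^ 2 * (y * g 1 1) + ϖ ^ (n / 2) * (g 0 0 * g 1 1 * b * u 1 1 +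
          ϖ * (ϖ ^ (n / 2) * ϖ ^ t * g 1 0 * b * (ϖ ^ (n / 2) * b * g 0 0 + y * u 1 1))) := by
      rw [h11]
      ring
    have h11' : residue 𝒪[F] ((g * u) 1 1) = residue 𝒪[F] (g 1 1) := by
      rw [h11]
      simp [residue_uniformizer hϖ, hd]
    rw [extendFun_of_eq hϖ h01, extendFun_of_eq hϖ hy, hprod, hφ.1, hφ.2 _ hd, h11', smul_smul]
    simp [residue_uniformizer hϖ, hd, hres']
  · have hg' : ¬ ϖ ^ (n + 1 - n / 2) ∣ (g * u) 0 1 := by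
      have h01 : (g * u) 0 1 = ϖ ^ (n + 1 - n / 2) * (ϖ ^ (n / 2) * b * g 0 0) +
          g 0 1 * u 1 1 := by
        rw [coe_mul_apply, hb, hl]
        ring
      rw [h01, dvd_add_right (dvd_mul_right _ _), hu.dvd_mul_right]
      exact hg
    rw [extendFun_of_not_dvd hg, extendFun_of_not_dvd hg', smul_zero]

lemma nonempty_mackeyEigen_equiv (hw : IsWhittaker σ ψ w₀ lam) (n : ℕ) :
    Nonempty (mackeyEigen hϖ σ (n + 1) ψ ≃ₗ[ℂ] equivariantFun ϖ (n / 2) ψ) := by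
  have hl : ϖ ^ (n + 1 - n / 2) * ϖ ^ (n / 2) = ϖ ^ (n + 1) := by
    rw [← pow_add]
    congr 1
    omega
  let E : mackeyEigen hϖ σ (n + 1) ψ →ₗ[ℂ] equivariantFun ϖ (n / 2) ψ :=
    { toFun f := ⟨fun y => lam (f.1.1 (upperUnipotent (ϖ ^ (n + 1 - n / 2) * y))), fun y b => by
          dsimp only
          rw [mul_add, ← mul_assoc, hl, upperUnipotent_add, mackeyEigen_apply hϖ f (c := b)
            (by simp [coe_upperUnipotent]) (by simp [coe_upperUnipotent]), map_smul,
            smul_eq_mul], fun a ha y => by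
          dsimp only
          obtain ⟨v, rfl⟩ : IsUnit a := by
            rw [← residue_ne_zero_iff_isUnit, ha]
            exact one_ne_zero
          have h1 := mackeyEigen_apply hϖ f (u := diagSL v) (c := 0) (by simp [coe_diagSL])
            (by simp [coe_diagSL, ha]) (upperUnipotent ((v : 𝒪[F]) ^ 2 *
              (ϖ ^ (n + 1 - n / 2) * y)))
          have hv : Units.map (residue 𝒪[F]).toMonoidHom v = 1 := Units.ext ha
          rw [← diagSL_mul_upperUnipotent, mackeyV_diagSL hϖ f.1, hv, diagSL_one, map_one,
            Module.End.one_apply, map_zero, ψ.map_zero_eq_one, one_smul] at h1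
          rw [mul_left_comm, h1]⟩
      map_add' f g := Subtype.ext (funext fun y => map_add lam _ _)
      map_smul' c f := Subtype.ext (funext fun y => map_smul lam _ _) }
  refine ⟨LinearEquiv.ofBijective E ⟨?_, ?_⟩⟩
  · rw [injective_iff_map_eq_zero]
    intro f hf
    exact mackeyEigen_eq_zero hϖ hw f fun y => congrFun (congrArg Subtype.val hf) y
  · rintro ⟨φ, hφ⟩
    refine ⟨⟨⟨extendFun σ w₀ ϖ (n + 1 - n / 2) φ, (mem_smoothIndV_iff hϖ σ n _).2
      (extendFun_lower hϖ hw hφ)⟩, fun u => ?_⟩, Subtype.ext (funext fun y => ?_)⟩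
    · obtain ⟨h, c, hc⟩ := u.2
      obtain ⟨b, hb⟩ := exists_eq_uniformizer_pow_mul hϖ ⟨u.1, h⟩
      have hmat := coe_mackeyRed hϖ ⟨u.1, h⟩ hb
      rw [hc] at hmat
      have h00 : 1 = residue 𝒪[F] (u.1 0 0) := congrFun (congrFun hmat 0) 0
      have h01 : c = residue 𝒪[F] b := congrFun (congrFun hmat 0) 1
      refine Subtype.ext (funext fun g => ?_)
      rw [mackey_apply, unipotentChar_eq hϖ ψ u hc, h01]
      exact extendFun_right hϖ hφ hb h00.symm g
    · change lam (extendFun σ w₀ ϖ (n + 1 - n / 2) φ _) = φ y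
      rw [extendFun_of_eq hϖ (y := y) rfl, map_smul]
      simp [coe_upperUnipotent, torusVec, diagSL_one, hw.lam_vec]

end LocalField

end BranchingSL2

theorem corollary5p6 {F : Type*} [Field F] [ValuativeRel F] [TopologicalSpace F]
    [IsNonarchimedeanLocalField F] [CharP 𝓀[F] 2]
    {ϖ : 𝒪[F]} (hϖ : Irreducible ϖ)
    {W : Type*} [AddCommGroup W] [Module ℂ W]
    (σ : Representation ℂ SL(2, 𝓀[F]) W) (hσ : BranchingSL2.IsCuspidal σ)
    (ℓ : ℕ) (hℓ : 1 ≤ ℓ) :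
    Module.finrank ℂ (Representation.IntertwiningMap
        (BranchingSL2.mackey hϖ σ ℓ) (BranchingSL2.mackey hϖ σ ℓ)) =
      Nat.card (BranchingSL2.SquareClasses F ⌈(ℓ : ℚ) / 2⌉₊) ∧
    ((ℓ : ℕ∞) ≤ 4 * BranchingSL2.ramIndex ϖ →
      Nat.card (BranchingSL2.SquareClasses F ⌈(ℓ : ℚ) / 2⌉₊) =
        Nat.card 𝓀[F] ^ ⌊((ℓ : ℚ) + 1) / 4⌋₊) ∧
    (∀ e : ℕ, BranchingSL2.ramIndex ϖ = e → 4 * e + 1 ≤ ℓ →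
      Nat.card (BranchingSL2.SquareClasses F ⌈(ℓ : ℚ) / 2⌉₊) = 2 * Nat.card 𝓀[F] ^ e) := by
  obtain ⟨n, rfl⟩ := Nat.exists_eq_add_of_le' hℓ
  rw [BranchingSL2.ceil_half, BranchingSL2.floor_quarter,
    show (n + 1 + 1) / 2 = n / 2 + 1 by omega, BranchingSL2.card_squareClasses]
  refine ⟨?_, fun h => ?_, fun e he h => ?_⟩
  · obtain ⟨ψ, w₀, lam, hw⟩ := hσ.exists_isWhittaker
    obtain ⟨E₁⟩ := BranchingSL2.nonempty_end_mackey_equiv hϖ hw n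
    obtain ⟨E₂⟩ := BranchingSL2.nonempty_mackeyEigen_equiv hϖ hw n
    rw [(E₁.trans E₂).finrank_eq, BranchingSL2.finrank_equivariantFun hϖ _ hw.ne_one]
  · rw [show (n + 1 + 1) / 4 = (n / 2 + 1) / 2 by omega]
    refine BranchingSL2.card_squareClasses_of_le hϖ ?_
    rw [BranchingSL2.ramIndex] at h
    generalize emultiplicity ϖ (2 : 𝒪[F]) = e at h
    induction e using ENat.recTopCoe with
    | top => exact le_top
    | coe e =>
      norm_cast at h ⊢
      omega
  · exact BranchingSL2.card_squareClasses_of_lt hϖ he (by omega)
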